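/- Let $F,T>0$ and $0<\epsilon\le 1$. Let $\mu$ be the uniform probability measure on $[-F,F]$, let $L_2(\mu)$ be the complex-valued functions square integrable with respect to $\mu$, with norm $\|\cdot\|_\mu$, and let $L_2(T)$ be those square integrable with respect to the uniform probability measure on $[0,T]$, with $\|z\|_T^2=\frac1T\int_0^T|z(t)|^2\,dt$. Put $$[\mathcal F_\mu f](\xi)=\frac1T\int_0^T f(t)e^{-2\pi i t\xi}\,dt,\qquad [\mathcal F_\mu^*g](t)=\int_{\mathbb R} g(\xi)e^{2\pi i\xi t}\,d\mu(\xi),\qquad \mathcal K_\mu=\mathcal F_\mu^*\mathcal F_\mu : L_2(T)\to L_2(T).$$ The ridge leverage function is $$\tau_{\mu,\epsilon}(t)=\frac1T\,\sup_{\alpha\in L_2(\mu),\ \|\alpha\|_\mu>0}\ \frac{|[\mathcal F_\mu^*\alpha](t)|^2}{\|\mathcal F_\mu^*\alpha\|_T^2+\epsilon\|\alpha\|_\mu^2},\qquad t\in[0,T],$$ and the statistical dimension is $s_{\mu,\epsilon}=\operatorname{tr}\big(\mathcal K_\mu(\mathcal K_\mu+\epsilon\mathcal I)^{-1}\big)$.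 Let $q=\lceil 16\pi e FT+2\log(1/\epsilon)+11\rceil$ (natural logarithm) and, for $t\in[0,T]$, $$\tilde\tau_{\mu,\epsilon}(t)=\frac1T\left(4+\frac{q}{\sqrt{\min(t,T-t)/T}}\right),$$ read as $+\infty$ at $t=0$ and $t=T$. There is an absolute constant $C>0$ such that for all $F,T>0$ and all $0<\epsilon\le1$: 1. $\tau_{\mu,\epsilon}(t)\le\tilde\tau_{\mu,\epsilon}(t)$ for all $t\in[0,T]$. 2. $\tilde s_{\mu,\epsilon}:=\int_0^T\tilde\tau_{\mu,\epsilon}(t)\,dt\le C\,\big(FT+\log(1/\epsilon)+1\big)$; in particular $\tilde s_{\mu,\epsilon}=O(FT+\log(1/\epsilon))$ as long as $FT+\log(1/\epsilon)$ is bounded below by a positive constant. 3. $\mathcal K_\mu+\epsilon\mathcal I$ is invertible, the trace defining $s_{\mu,\epsilon}$ exists (the diagonal sum converges, to the same value, in every orthonormal basis of $L_2(T)$), and $s_{\mu,\epsilon}\le\tilde s_{\mu,\epsilon}$, so that $s_{\mu,\epsilon}\le C\,(FT+\log(1/\epsilon)+1)$. -/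

import Mathlib

open MeasureTheory
open scoped ENNReal InnerProductSpace

noncomputable section

namespace FourierFit

/-- The uniform probability measure on `[a, b]` (for `a < b`). -/
def unif (a b : ℝ) : Measure ℝ := ProbabilityTheory.cond volume (Set.Icc a b)

instance unif_isFiniteMeasure (a b : ℝ) : IsFiniteMeasure (unif a b) := by
  unfold unif; infer_instance

/-- The pointwise value `∫ f(x) exp(2 π i σ x s) dν(x)`; the sign `σ = -1` gives the Fourier
transform of `f` with respect to `ν`, the sign `σ = 1` the inverse Fourier transform. -/
def expIntegral (σ : ℝ) (ν : Measure ℝ) (f : ℝ → ℂ) (s : ℝ) : ℂ :=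
  ∫ x, f x * Complex.exp (2 * Real.pi * Complex.I * σ * x * s) ∂ν

theorem norm_exp_char (σ x s : ℝ) :
    ‖Complex.exp (2 * Real.pi * Complex.I * σ * x * s)‖ = 1 := by
  have h : (2 * Real.pi * Complex.I * σ * x * s : ℂ)
      = ((2 * Real.pi * σ * x * s : ℝ) : ℂ) * Complex.I := by
    push_cast; ring
  rw [h, Complex.norm_exp_ofReal_mul_I]

theorem integrable_exp_mul (σ : ℝ) (ν : Measure ℝ) [IsFiniteMeasure ν] (f : Lp ℂ 2 ν) (s : ℝ) :
    Integrable (fun x : ℝ => f x * Complex.exp (2 * Real.pi * Complex.I * σ * x * s)) ν := by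
  have hf : Integrable f ν := (Lp.memLp f).integrable (by norm_num)
  refine hf.mul_bdd (c := 1) ?_ (Filter.Eventually.of_forall fun x => (norm_exp_char σ x s).le)
  exact Continuous.aestronglyMeasurable (by fun_prop)

theorem expIntegral_add (σ : ℝ) (ν : Measure ℝ) [IsFiniteMeasure ν] (f g : Lp ℂ 2 ν) (s : ℝ) :
    expIntegral σ ν (f + g : Lp ℂ 2 ν) s = expIntegral σ ν f s + expIntegral σ ν g s := by
  unfold expIntegral
  rw [← integral_add (integrable_exp_mul σ ν f s) (integrable_exp_mul σ ν g s)]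
  refine integral_congr_ae ?_
  filter_upwards [Lp.coeFn_add f g] with x hx
  rw [hx, Pi.add_apply, add_mul]

theorem expIntegral_smul (σ : ℝ) (ν : Measure ℝ) (c : ℂ) (f : Lp ℂ 2 ν) (s : ℝ) :
    expIntegral σ ν (c • f : Lp ℂ 2 ν) s = c * expIntegral σ ν f s := by
  unfold expIntegral
  rw [← integral_const_mul]
  refine integral_congr_ae ?_
  filter_upwards [Lp.coeFn_smul c f] with x hx
  rw [hx, Pi.smul_apply, smul_eq_mul, mul_assoc]

theorem memLp_exp_char (σ : ℝ) (ν : Measure ℝ) [IsFiniteMeasure ν] (s : ℝ) :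
    MemLp (fun x : ℝ => Complex.exp (-(2 * Real.pi * Complex.I * σ * x * s))) 2 ν := by
  refine MemLp.of_bound (Continuous.aestronglyMeasurable (by fun_prop)) 1
    (Filter.Eventually.of_forall fun x => ?_)
  rw [Complex.exp_neg, norm_inv, norm_exp_char, inv_one]

theorem norm_expIntegral_le (σ : ℝ) (ν : Measure ℝ) [IsFiniteMeasure ν] (f : Lp ℂ 2 ν) (s : ℝ) :
    ‖expIntegral σ ν f s‖ ≤ measureUnivNNReal ν ^ (2 : ℝ≥0∞).toReal⁻¹ * ‖f‖ := by
  have h : expIntegral σ ν f s = ⟪(memLp_exp_char σ ν s).toLp _, f⟫_ℂ := by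
    rw [L2.inner_def]
    refine integral_congr_ae ?_
    filter_upwards [(memLp_exp_char σ ν s).coeFn_toLp] with x hx
    rw [hx, RCLike.inner_apply, ← Complex.exp_conj]
    congr 2
    simp [Complex.conj_ofNat]
  rw [h]
  refine (norm_inner_le_norm _ _).trans (mul_le_mul_of_nonneg_right ?_ (norm_nonneg _))
  have hb := Lp.norm_le_of_ae_bound (f := (memLp_exp_char σ ν s).toLp _) (C := 1) zero_le_one
    (by
      filter_upwards [(memLp_exp_char σ ν s).coeFn_toLp] with x hx
      rw [hx, Complex.exp_neg, norm_inv, norm_exp_char, inv_one])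
  simpa using hb

theorem memLp_expIntegral (σ : ℝ) (ν ρ : Measure ℝ) [IsFiniteMeasure ν] [IsFiniteMeasure ρ]
    (f : Lp ℂ 2 ν) : MemLp (expIntegral σ ν f) 2 ρ := by
  refine MemLp.of_bound ?_ _ (Filter.Eventually.of_forall (norm_expIntegral_le σ ν f))
  have h : StronglyMeasurable (fun p : ℝ × ℝ =>
      f p.2 * Complex.exp (2 * Real.pi * Complex.I * σ * p.2 * p.1)) := by
    refine ((Lp.stronglyMeasurable f).comp_measurable measurable_snd).mul ?_
    exact Continuous.stronglyMeasurable (by fun_prop)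
  exact h.integral_prod_right.aestronglyMeasurable

/-- `f ↦ ∫ f(x) exp(2 π i σ x ·) dν(x)` as a bounded operator `L₂(ν) → L₂(ρ)`. -/
def expOp (σ : ℝ) (ν ρ : Measure ℝ) [IsFiniteMeasure ν] [IsFiniteMeasure ρ] :
    Lp ℂ 2 ν →L[ℂ] Lp ℂ 2 ρ :=
  LinearMap.mkContinuous
    { toFun := fun f => (memLp_expIntegral σ ν ρ f).toLp (expIntegral σ ν f)
      map_add' := fun f g => by
        rw [← MemLp.toLp_add]
        exact MemLp.toLp_congr _ _
          (Filter.Eventually.of_forall fun s => expIntegral_add σ ν f g s)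
      map_smul' := fun c f => by
        rw [RingHom.id_apply, ← MemLp.toLp_const_smul]
        exact MemLp.toLp_congr _ _
          (Filter.Eventually.of_forall fun s => expIntegral_smul σ ν c f s) }
    (measureUnivNNReal ρ ^ (2 : ℝ≥0∞).toReal⁻¹ * measureUnivNNReal ν ^ (2 : ℝ≥0∞).toReal⁻¹)
    (fun f => by
      have h := Lp.norm_le_of_ae_bound
        (f := (memLp_expIntegral σ ν ρ f).toLp (expIntegral σ ν f))
        (C := measureUnivNNReal ν ^ (2 : ℝ≥0∞).toReal⁻¹ * ‖f‖) (by positivity)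
        (by
          filter_upwards [(memLp_expIntegral σ ν ρ f).coeFn_toLp] with x hx
          rw [hx]
          exact norm_expIntegral_le σ ν f x)
      rw [mul_assoc]
      exact h)

/-- `L₂(T)`: square integrable functions for the uniform probability measure on `[0, T]`. -/
abbrev L2T (T : ℝ) : Type := Lp ℂ 2 (unif 0 T)

/-- `[F_μ f](ξ) = (1/T) ∫_0^T f(t) exp(-2 π i t ξ) dt`, from `L₂(T)` to `L₂(μ)`. -/
def fourier (μ : Measure ℝ) [IsFiniteMeasure μ] (T : ℝ) : L2T T →L[ℂ] Lp ℂ 2 μ :=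
  expOp (-1) (unif 0 T) μ

/-- `[F_μ^* g](t) = ∫ g(ξ) exp(2 π i ξ t) dμ(ξ)`, from `L₂(μ)` to `L₂(T)`. -/
def invFourier (μ : Measure ℝ) [IsFiniteMeasure μ] (T : ℝ) : Lp ℂ 2 μ →L[ℂ] L2T T :=
  expOp 1 μ (unif 0 T)

/-- The kernel operator `[K_μ z](t) = ∫ exp(2 π i ξ t) ((1/T) ∫_0^T z(s) exp(-2 π i ξ s) ds) dμ(ξ)`
on `L₂(T)`. -/
def kernelOp (μ : Measure ℝ) [IsFiniteMeasure μ] (T : ℝ) : L2T T →L[ℂ] L2T T :=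
  (invFourier μ T).comp (fourier μ T)

/-- `A` has trace `s`: in every orthonormal basis the diagonal of `A` sums to `s`. -/
def HasTrace {H : Type} [NormedAddCommGroup H] [InnerProductSpace ℂ H] (A : H →L[ℂ] H) (s : ℂ) :
    Prop :=
  ∀ (ι : Type) (b : HilbertBasis ι ℂ H), HasSum (fun i => ⟪b i, A (b i)⟫_ℂ) s

open Classical in
/-- The trace of `A` (with value `0` if `A` has no trace). -/
def opTrace {H : Type} [NormedAddCommGroup H] [InnerProductSpace ℂ H] (A : H →L[ℂ] H) : ℂ :=
  if h : ∃ s, HasTrace A s then h.choose else 0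

/-- The operator `K_μ (K_μ + ε I)⁻¹` on `L₂(T)`. -/
def ridgeOp (μ : Measure ℝ) [IsFiniteMeasure μ] (T ε : ℝ) : L2T T →L[ℂ] L2T T :=
  kernelOp μ T * Ring.inverse (kernelOp μ T + (ε : ℂ) • (1 : L2T T →L[ℂ] L2T T))

/-- The statistical dimension `s_{μ,ε} = tr (K_μ (K_μ + ε I)⁻¹)`. -/
def statDim (μ : Measure ℝ) [IsFiniteMeasure μ] (T ε : ℝ) : ℝ :=
  (opTrace (ridgeOp μ T ε)).re

/-- The ridge leverage function
`τ_{μ,ε}(t) = (1/T) sup_{‖α‖_μ > 0} |[F_μ^* α](t)|² / (‖F_μ^* α‖_T² + ε ‖α‖_μ²)`, where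
`[F_μ^* α](t)` is the pointwise value of the integral. -/
def leverage (μ : Measure ℝ) [IsFiniteMeasure μ] (T ε t : ℝ) : ℝ≥0∞ :=
  ENNReal.ofReal (1 / T) * ⨆ (α : Lp ℂ 2 μ) (_ : 0 < ‖α‖),
    ENNReal.ofReal (‖expIntegral 1 μ α t‖ ^ 2) /
      ENNReal.ofReal (‖invFourier μ T α‖ ^ 2 + ε * ‖α‖ ^ 2)

/-- `q = ⌈16 π e F T + 2 log(1/ε) + 11⌉`. -/
def bandDegree (F T ε : ℝ) : ℕ :=
  ⌈16 * Real.pi * Real.exp 1 * F * T + 2 * Real.log (1 / ε) + 11⌉₊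

/-- The approximate ridge leverage function `(1/T) (4 + q / √(min(t, T - t) / T))`, with the
value `∞` at the end points `t = 0` and `t = T`. -/
def approxLeverage (F T ε t : ℝ) : ℝ≥0∞ :=
  ENNReal.ofReal (1 / T) *
    (4 + (bandDegree F T ε : ℝ≥0∞) / ENNReal.ofReal (Real.sqrt (min t (T - t) / T)))

/-- The total mass of the approximate ridge leverage function on `[0, T]`. -/
def approxStatDim (F T ε : ℝ) : ℝ≥0∞ :=
  ∫⁻ t in Set.Icc 0 T, approxLeverage F T ε t

end FourierFit

end

noncomputable section

namespace FourierFit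

open Real Finset

/-! ### Trigonometric sums on `[0, π]` -/

/-! A function band limited to `[-F, F]` is, on `[0, T]`, nearly a polynomial of degree of order `FT
+ log(1/ε)`, and a polynomial of degree below `n` cannot be large at a point compared with its L²
norm.

Polynomials. With `s = cos θ`, Lebesgue measure on `[-1, 1]` becomes `sin θ dθ`, and a polynomial in
`cos θ` times `sin θ` is a sine polynomial. Pairing it with a sine kernel peaking at `θ₀`, tapered
to be exact up to degree `n`, reproduces its value at `θ₀`. Cauchy–Schwarz with weight `sin θ` then
gives `‖P θ₀‖² sin θ₀ ≤ (6.6 / π) n ∫ ‖P‖² sin` (`norm_sq_cosPoly_mul_sin_le`). The linear taper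
matters: a sharp cutoff leaves boundary coefficients that are not small when `sin θ₀` is small.

Leverage. Taylor expansion of the exponential about the midpoint of `[0, T]` gives the polynomial,
with error at most `2 · 4⁻ⁿ ‖α‖`, absorbed by `ε ‖α‖²` (`exists_cosPoly_near`,
`sq_taylor_error_le`). Since `sin² θ₀ ≥ 2 min(t, T - t) / T`, the claimed pointwise bound follows
(`norm_sq_expIntegral_le`). Its singularities at the end points are inverse square roots, hence
integrable.

Trace. With `A = F_μ^*` and `S = (A†A + ε)^(-1/2)`, the ridge operator is `Q†Q` for `Q = S A†`, so
its trace is the squared Hilbert–Schmidt norm of `A S`. Writing evaluation at `t` as `⟪φ_t, ·⟫`,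
this is bounded by the mean over `t` of `‖S φ_t‖²`, to which the pointwise bound applies by duality
(`norm_sqrtResolvent_sq_le`). -/

theorem integral_cos_int_mul (m : ℤ) :
    ∫ θ in (0 : ℝ)..π, cos (m * θ) = if m = 0 then π else 0 := by
  split_ifs with h
  · simp [h]
  · have hm : (m : ℝ) ≠ 0 := by exact_mod_cast h
    rw [intervalIntegral.integral_comp_mul_left (fun x => cos x) hm, integral_cos]
    simp [sin_int_mul_pi]

theorem integral_cos_mul_cos (j k : ℕ) :
    ∫ θ in (0 : ℝ)..π, cos (j * θ) * cos (k * θ) =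
      if j = k then (if j = 0 then π else π / 2) else 0 := by
  have h : ∀ θ : ℝ, cos (j * θ) * cos (k * θ) =
      (cos (((j : ℤ) - k : ℤ) * θ) + cos (((j : ℤ) + k : ℤ) * θ)) / 2 := by
    intro θ
    push_cast
    rw [sub_mul, add_mul, cos_sub, cos_add]
    ring
  simp_rw [h]
  rw [intervalIntegral.integral_div, intervalIntegral.integral_add
    (Continuous.intervalIntegrable (by fun_prop) _ _)
    (Continuous.intervalIntegrable (by fun_prop) _ _),
    integral_cos_int_mul, integral_cos_int_mul]
  split_ifs <;> first | omega | ring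

theorem integral_sin_mul_sin (j k : ℕ) :
    ∫ θ in (0 : ℝ)..π, sin (j * θ) * sin (k * θ) =
      if j = k then (if j = 0 then 0 else π / 2) else 0 := by
  have h : ∀ θ : ℝ, sin (j * θ) * sin (k * θ) =
      (cos (((j : ℤ) - k : ℤ) * θ) - cos (((j : ℤ) + k : ℤ) * θ)) / 2 := by
    intro θ
    push_cast
    rw [sub_mul, add_mul, cos_sub, cos_add]
    ring
  simp_rw [h]
  rw [intervalIntegral.integral_div, intervalIntegral.integral_sub
    (Continuous.intervalIntegrable (by fun_prop) _ _)
    (Continuous.intervalIntegrable (by fun_prop) _ _),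
    integral_cos_int_mul, integral_cos_int_mul]
  split_ifs <;> first | omega | ring

/-- The sine sum `∑_{j < N} a_j sin (j θ)`. -/
def sinSum (a : ℕ → ℝ) (N : ℕ) (θ : ℝ) : ℝ := ∑ j ∈ range N, a j * sin (j * θ)

@[fun_prop]
theorem continuous_sinSum (a : ℕ → ℝ) (N : ℕ) : Continuous (sinSum a N) := by
  unfold sinSum; fun_prop

theorem integral_sin_mul_sinSum (a : ℕ → ℝ) (ha : a 0 = 0) (N j : ℕ) (hj : j < N) :
    ∫ θ in (0 : ℝ)..π, sin (j * θ) * sinSum a N θ = π / 2 * a j := by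
  unfold sinSum
  simp_rw [mul_sum]
  rw [intervalIntegral.integral_finsetSum
    (fun i _ => Continuous.intervalIntegrable (by fun_prop) _ _)]
  have h : ∀ i ∈ range N, ∫ θ in (0 : ℝ)..π, sin (j * θ) * (a i * sin (i * θ)) =
      if j = i then π / 2 * a j else 0 := by
    intro i _
    simp_rw [mul_left_comm _ (a i)]
    rw [intervalIntegral.integral_const_mul, integral_sin_mul_sin]
    split_ifs with h1 h2
    · subst h1; simp [h2, ha]
    · subst h1; ring
    · simp
  rw [sum_congr rfl h]
  simp [hj]

theorem integral_sinSum_sq (a : ℕ → ℝ) (ha : a 0 = 0) (N : ℕ) :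
    ∫ θ in (0 : ℝ)..π, sinSum a N θ ^ 2 = π / 2 * ∑ j ∈ range N, a j ^ 2 := by
  have h : ∀ θ : ℝ, sinSum a N θ ^ 2 =
      ∑ j ∈ range N, a j * (sin (j * θ) * sinSum a N θ) := by
    intro θ
    rw [sq]
    nth_rewrite 1 [sinSum]
    rw [sum_mul]
    exact sum_congr rfl fun j _ => by ring
  simp_rw [h]
  rw [intervalIntegral.integral_finsetSum
    (fun i _ => Continuous.intervalIntegrable (by fun_prop) _ _), mul_sum]
  refine sum_congr rfl fun j hj => ?_
  rw [intervalIntegral.integral_const_mul, integral_sin_mul_sinSum a ha N j (mem_range.1 hj)]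
  ring

/-- Orthogonality; `e 0` counts twice because the constant has squared norm `π` instead of `π / 2`.
-/
theorem integral_cosSum_sq (e : ℕ → ℝ) (N : ℕ) (hN : 0 < N) :
    ∫ θ in (0 : ℝ)..π, (∑ m ∈ range N, e m * cos (m * θ)) ^ 2 =
      π / 2 * (e 0 ^ 2 + ∑ m ∈ range N, e m ^ 2) := by
  have h : ∀ θ : ℝ, (∑ m ∈ range N, e m * cos (m * θ)) ^ 2 =
      ∑ i ∈ range N, ∑ j ∈ range N, e i * e j * (cos (i * θ) * cos (j * θ)) := by
    intro θ
    rw [sq, sum_mul_sum]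
    exact sum_congr rfl fun i _ => sum_congr rfl fun j _ => by ring
  simp_rw [h]
  rw [intervalIntegral.integral_finsetSum
    (fun i _ => Continuous.intervalIntegrable (by fun_prop) _ _)]
  have h1 : ∀ i ∈ range N, ∫ θ in (0 : ℝ)..π, ∑ j ∈ range N,
      e i * e j * (cos (i * θ) * cos (j * θ)) =
      π / 2 * e i ^ 2 + if 0 = i then π / 2 * e 0 ^ 2 else 0 := by
    intro i hi
    rw [intervalIntegral.integral_finsetSum
      (fun i _ => Continuous.intervalIntegrable (by fun_prop) _ _)]
    simp_rw [intervalIntegral.integral_const_mul, integral_cos_mul_cos]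
    simp only [mul_ite, mul_zero, sum_ite_eq, hi, if_true]
    rcases eq_or_ne i 0 with rfl | h0
    · simp; ring
    · simp [h0, Ne.symm h0]; ring
  rw [sum_congr rfl h1, sum_add_distrib, sum_ite_eq, if_pos (mem_range.2 hN), ← mul_sum]
  ring

/-- Product-to-sum and a shift of indices. At `m = 0` truncated subtraction reads `a 0 = 0`, which
is the correct coefficient. -/
theorem sinSum_mul_sin (a : ℕ → ℝ) (N : ℕ) (ha : ∀ j, N ≤ j → a j = 0) (ha0 : a 0 = 0) (θ : ℝ) :
    sinSum a N θ * sin θ =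
      ∑ m ∈ range (N + 1), (a (m + 1) - a (m - 1)) / 2 * cos (m * θ) := by
  have h1 : ∑ m ∈ range (N + 1), a (m + 1) * cos (m * θ) =
      ∑ j ∈ range N, a j * cos ((j - 1) * θ) := by
    rw [sum_range_succ, ha (N + 1) (by omega), zero_mul, add_zero]
    have h2 := sum_range_succ' (fun j : ℕ => a j * cos (((j : ℝ) - 1) * θ)) N
    rw [sum_range_succ, ha N le_rfl, ha0] at h2
    simpa using h2.symm
  have h2 : ∑ m ∈ range (N + 1), a (m - 1) * cos (m * θ) =
      ∑ j ∈ range N, a j * cos ((j + 1) * θ) := by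
    rw [sum_range_succ']
    simp [ha0]
  simp_rw [sub_div, sub_mul, sum_sub_distrib, div_mul_eq_mul_div, ← sum_div]
  rw [h1, h2, sinSum, sum_mul, ← sub_div, ← sum_sub_distrib, sum_div]
  refine sum_congr rfl fun j _ => ?_
  rw [sub_mul, add_mul, cos_sub, cos_add]
  simp only [one_mul]
  ring

/-! ### The tapered sine kernel and its weighted norm. -/

theorem abs_sin_nat_mul_le (m : ℕ) (θ : ℝ) : |sin (m * θ)| ≤ m * |sin θ| := by
  induction m with
  | zero => simp
  | succ m ih =>
    push_cast
    rw [add_mul, one_mul, sin_add]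
    calc |sin (m * θ) * cos θ + cos (m * θ) * sin θ|
        ≤ |sin (m * θ)| * |cos θ| + |cos (m * θ)| * |sin θ| := by
          rw [← abs_mul, ← abs_mul]; exact abs_add_le _ _
      _ ≤ |sin (m * θ)| * 1 + 1 * |sin θ| := by
          gcongr
          · exact abs_cos_le_one _
          · exact abs_cos_le_one _
      _ ≤ (m + 1) * |sin θ| := by linarith

/-- The trapezoidal taper: `1` for `j ≤ n`, linear on `[n, 2n]`, `0` from `2n` on. -/
def taper (n j : ℕ) : ℝ := max 0 (min 1 (2 - j / n))

theorem taper_of_le {n j : ℕ} (hn : 0 < n) (h : j ≤ n) : taper n j = 1 := by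
  have hn' : (0 : ℝ) < n := by exact_mod_cast hn
  have : (j : ℝ) / n ≤ 1 := by rw [div_le_one hn']; exact_mod_cast h
  rw [taper, min_eq_left (by linarith), max_eq_right zero_le_one]

theorem taper_of_mem {n j : ℕ} (hn : 0 < n) (h : n ≤ j) (h' : j ≤ 2 * n) :
    taper n j = 2 - j / n := by
  have hn' : (0 : ℝ) < n := by exact_mod_cast hn
  have h1 : 1 ≤ (j : ℝ) / n := by rw [one_le_div hn']; exact_mod_cast h
  have h2 : (j : ℝ) / n ≤ 2 := by rw [div_le_iff₀ hn']; exact_mod_cast h'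
  rw [taper, min_eq_right (by linarith), max_eq_right (by linarith)]

theorem taper_of_ge {n j : ℕ} (hn : 0 < n) (h : 2 * n ≤ j) : taper n j = 0 := by
  have hn' : (0 : ℝ) < n := by exact_mod_cast hn
  have h2 : 2 ≤ (j : ℝ) / n := by rw [le_div_iff₀ hn']; exact_mod_cast h
  exact max_eq_left ((min_le_right _ _).trans (by linarith))

/-- The coefficients of the kernel peaking at `θ`. -/
def kernelCoeff (n : ℕ) (θ : ℝ) (j : ℕ) : ℝ := taper n j * sin (j * θ)

theorem kernelCoeff_zero (n : ℕ) (θ : ℝ) : kernelCoeff n θ 0 = 0 := by simp [kernelCoeff]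

/-- `cos θ ^ k * sin (j θ)` is a combination of sines of frequency at most `k + j ≤ n`, where the
taper is `1`, so the kernel reproduces it. -/
theorem integral_cos_pow_mul_kernel {n : ℕ} (hn : 0 < n) (θ₀ : ℝ) (k j : ℕ) (h : k + j ≤ n) :
    ∫ θ in (0 : ℝ)..π, cos θ ^ k * sin (j * θ) * sinSum (kernelCoeff n θ₀) (2 * n) θ =
      π / 2 * (cos θ₀ ^ k * sin (j * θ₀)) := by
  induction k generalizing j with
  | zero =>
    simp only [pow_zero, one_mul]
    rw [integral_sin_mul_sinSum _ (kernelCoeff_zero n θ₀) _ _ (by omega), kernelCoeff,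
      taper_of_le hn (by omega), one_mul]
  | succ k ih =>
    rcases j with _ | j
    · simp
    · have h1 : ∀ θ : ℝ, cos θ ^ (k + 1) * sin ((j + 1 : ℕ) * θ) =
          (cos θ ^ k * sin ((j + 2 : ℕ) * θ) + cos θ ^ k * sin (j * θ)) / 2 := by
        intro θ
        have e1 : ((j + 2 : ℕ) : ℝ) * θ = (j + 1 : ℕ) * θ + θ := by push_cast; ring
        have e2 : (j : ℝ) * θ = (j + 1 : ℕ) * θ - θ := by push_cast; ring
        rw [e1, e2, sin_add, sin_sub]
        ring
      simp_rw [h1, div_mul_eq_mul_div, add_mul]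
      rw [intervalIntegral.integral_div, intervalIntegral.integral_add
        (Continuous.intervalIntegrable (by fun_prop) _ _)
        (Continuous.intervalIntegrable (by fun_prop) _ _), ih _ (by omega), ih _ (by omega)]
      ring

/-- The combination of the squares of the coefficients of the kernel and of its product with
`sin`. -/
theorem kernelCoeff_sq_add_le_of_lt {n m : ℕ} (hn : 0 < n) (hm : m < n) (θ : ℝ) :
    sin θ ^ 2 * kernelCoeff n θ m ^ 2 +
      ((kernelCoeff n θ (m + 1) - kernelCoeff n θ (m - 1)) / 2) ^ 2 ≤ sin θ ^ 2 := by
  rcases m with _ | m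
  · simp only [zero_add, kernelCoeff, taper_of_le hn hn]
    simp
    nlinarith [sq_nonneg (sin θ)]
  · simp only [kernelCoeff, Nat.add_sub_cancel]
    rw [taper_of_le hn (by omega), taper_of_le hn (by omega), taper_of_le hn (by omega)]
    have e1 : ((m + 1 + 1 : ℕ) : ℝ) * θ = (m + 1 : ℕ) * θ + θ := by push_cast; ring
    have e2 : (m : ℝ) * θ = (m + 1 : ℕ) * θ - θ := by push_cast; ring
    rw [e1, e2, sin_add, sin_sub]
    have := sin_sq_add_cos_sq (((m + 1 : ℕ) : ℝ) * θ)
    set S := sin (((m + 1 : ℕ) : ℝ) * θ)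
    set D := cos (((m + 1 : ℕ) : ℝ) * θ)
    -- Where the taper is constant, the half-difference is `D * sin θ`, so Pythagoras gives
    -- equality.
    apply le_of_eq
    linear_combination (sin θ ^ 2) * this

/-- The half-difference of coefficients is the mean of the neighbouring tapers times `cos (m θ) sin
θ` plus their half-difference times `sin (m θ) cos θ`. The bound `|sin (m θ)| ≤ m |sin θ|` makes the
second part proportional to `sin θ` too. The `2` in `h0` matches the loss in `(p + q)² ≤ 2p² + 2q²`,
so that the squares of `sin (m θ)` and `cos (m θ)` recombine. -/
theorem kernelCoeff_sq_add_le (n m : ℕ) (hm : 0 < m) (θ : ℝ) (A d : ℝ)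
    (h0 : taper n m ^ 2 ≤ 2 * A ^ 2)
    (h1 : ((taper n (m + 1) + taper n (m - 1)) / 2) ^ 2 ≤ A ^ 2)
    (h2 : ((taper n (m + 1) - taper n (m - 1)) / 2) ^ 2 ≤ d ^ 2) :
    sin θ ^ 2 * kernelCoeff n θ m ^ 2 +
      ((kernelCoeff n θ (m + 1) - kernelCoeff n θ (m - 1)) / 2) ^ 2 ≤
      sin θ ^ 2 * (2 * A ^ 2 + 2 * (d * m) ^ 2) := by
  obtain ⟨m, rfl⟩ : ∃ k, m = k + 1 := ⟨m - 1, by omega⟩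
  simp only [kernelCoeff, Nat.add_sub_cancel] at *
  have e1 : ((m + 1 + 1 : ℕ) : ℝ) * θ = (m + 1 : ℕ) * θ + θ := by push_cast; ring
  have e2 : (m : ℝ) * θ = (m + 1 : ℕ) * θ - θ := by push_cast; ring
  have hS : sin ((m + 1 : ℕ) * θ) ^ 2 ≤ ((m + 1 : ℕ) : ℝ) ^ 2 * sin θ ^ 2 := by
    rw [← mul_pow, ← sq_abs (sin _), ← sq_abs (_ * sin θ), abs_mul, Nat.abs_cast]
    exact pow_le_pow_left₀ (abs_nonneg _) (abs_sin_nat_mul_le _ _) 2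
  rw [e1, e2, sin_add, sin_sub]
  have h := sin_sq_add_cos_sq (((m + 1 : ℕ) : ℝ) * θ)
  set S := sin (((m + 1 : ℕ) : ℝ) * θ)
  set D := cos (((m + 1 : ℕ) : ℝ) * θ)
  set c := taper n (m + 1)
  set x := taper n (m + 1 + 1)
  set y := taper n m
  set M := ((m + 1 : ℕ) : ℝ)
  have k1 : ((x * (S * cos θ + D * sin θ) - y * (S * cos θ - D * sin θ)) / 2) ^ 2 ≤
      2 * (((x + y) / 2) ^ 2 * D ^ 2 * sin θ ^ 2) + 2 * (((x - y) / 2) ^ 2 * S ^ 2) := by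
    have e : (x * (S * cos θ + D * sin θ) - y * (S * cos θ - D * sin θ)) / 2 =
        (x + y) / 2 * D * sin θ + (x - y) / 2 * S * cos θ := by ring
    rw [e]
    have hc : cos θ ^ 2 ≤ 1 := cos_sq_le_one θ
    calc ((x + y) / 2 * D * sin θ + (x - y) / 2 * S * cos θ) ^ 2
        ≤ 2 * ((x + y) / 2 * D * sin θ) ^ 2 + 2 * ((x - y) / 2 * S * cos θ) ^ 2 := by
          linarith [two_mul_le_add_sq ((x + y) / 2 * D * sin θ) ((x - y) / 2 * S * cos θ)]
      _ ≤ _ := by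
          have : ((x - y) / 2 * S * cos θ) ^ 2 ≤ ((x - y) / 2) ^ 2 * S ^ 2 := by
            rw [mul_pow, mul_pow]
            exact mul_le_of_le_one_right (by positivity) hc
          nlinarith
  have k2 : ((x - y) / 2) ^ 2 * S ^ 2 ≤ d ^ 2 * (M ^ 2 * sin θ ^ 2) := by gcongr
  have k3 : ((x + y) / 2) ^ 2 * D ^ 2 * sin θ ^ 2 ≤ A ^ 2 * D ^ 2 * sin θ ^ 2 := by gcongr
  have k4 : sin θ ^ 2 * (c * S) ^ 2 ≤ 2 * A ^ 2 * S ^ 2 * sin θ ^ 2 := by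
    calc sin θ ^ 2 * (c * S) ^ 2 = c ^ 2 * S ^ 2 * sin θ ^ 2 := by ring
      _ ≤ _ := by gcongr
  have k5 : 2 * A ^ 2 * S ^ 2 * sin θ ^ 2 + 2 * (A ^ 2 * D ^ 2 * sin θ ^ 2) =
      2 * A ^ 2 * sin θ ^ 2 := by linear_combination 2 * A ^ 2 * sin θ ^ 2 * h
  nlinarith

theorem kernelCoeff_sq_add_le_of_add {n k : ℕ} (hn : 0 < n) (hk : k < n) (θ : ℝ) :
    sin θ ^ 2 * kernelCoeff n θ (n + k) ^ 2 +
      ((kernelCoeff n θ (n + k + 1) - kernelCoeff n θ (n + k - 1)) / 2) ^ 2 ≤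
      sin θ ^ 2 * (4 * ((k : ℝ) ^ 2 / n ^ 2 + 1)) := by
  have hn' : (0 : ℝ) < n := by exact_mod_cast hn
  have hnn : (n : ℝ) / n = 1 := div_self hn'.ne'
  rcases k with _ | k
  · have h1 : taper n n = 1 := taper_of_le hn le_rfl
    have h2 : taper n (n + 1) = 1 - 1 / n := by
      rw [taper_of_mem hn (by omega) (by omega)]
      push_cast
      rw [add_div, hnn]; ring
    have h3 : taper n (n - 1) = 1 := taper_of_le hn (by omega)
    have hi : 1 / (n : ℝ) ≤ 1 := by rw [div_le_one hn']; exact_mod_cast hn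
    have hp : 0 < 1 / (n : ℝ) := by positivity
    -- At the corner only one neighbour lies on the slope, so `d` is halved.
    refine (kernelCoeff_sq_add_le n n hn θ 1 (1 / (2 * n)) ?_ ?_ ?_).trans ?_
    · rw [h1]; norm_num
    · rw [h2, h3]; nlinarith
    · rw [h2, h3]; apply le_of_eq; field_simp; ring
    · have : 1 / (2 * (n : ℝ)) * n = 1 / 2 := by field_simp
      rw [this]
      gcongr
      norm_num
  · have h1 : taper n (n + (k + 1)) = 1 - (k + 1) / n := by
      rw [taper_of_mem hn (by omega) (by omega)]
      push_cast
      rw [add_div, hnn]; ring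
    have h2 : taper n (n + (k + 1) + 1) = 1 - (k + 2) / n := by
      rw [taper_of_mem hn (by omega) (by omega)]
      push_cast
      rw [add_assoc, add_div, hnn]; ring
    have h3 : taper n (n + (k + 1) - 1) = 1 - k / n := by
      rw [show n + (k + 1) - 1 = n + k by omega, taper_of_mem hn (by omega) (by omega)]
      push_cast
      rw [add_div, hnn]; ring
    -- With `r = (k + 1) / n`, `A = 1 - r` and `d * m = 1 + r`, so the bound is `4 (1 + r²)`.
    refine (kernelCoeff_sq_add_le n _ (by omega) θ (1 - (k + 1) / n) (1 / n) ?_ ?_ ?_).trans ?_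
    · rw [h1]; nlinarith [sq_nonneg (1 - ((k : ℝ) + 1) / n)]
    · rw [h2, h3]; apply le_of_eq; ring
    · rw [h2, h3]; apply le_of_eq; ring
    · gcongr
      apply le_of_eq
      push_cast
      field_simp
      ring

theorem kernelCoeff_sq_add_le_two_mul {n : ℕ} (hn : 0 < n) (θ : ℝ) :
    sin θ ^ 2 * kernelCoeff n θ (2 * n) ^ 2 +
      ((kernelCoeff n θ (2 * n + 1) - kernelCoeff n θ (2 * n - 1)) / 2) ^ 2 ≤
      sin θ ^ 2 * (2 + 1 / (2 * n ^ 2)) := by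
  have hn' : (0 : ℝ) < n := by exact_mod_cast hn
  have h1 : taper n (2 * n) = 0 := taper_of_ge hn le_rfl
  have h2 : taper n (2 * n + 1) = 0 := taper_of_ge hn (by omega)
  have h3 : taper n (2 * n - 1) = 1 / n := by
    rw [taper_of_mem hn (by omega) (by omega), Nat.cast_sub (by omega)]
    push_cast
    field_simp
    ring
  refine (kernelCoeff_sq_add_le n _ (by omega) θ (1 / (2 * n)) (1 / (2 * n)) ?_ ?_ ?_).trans ?_
  · rw [h1, zero_pow two_ne_zero]; positivity
  · rw [h2, h3]; apply le_of_eq; field_simp; ring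
  · rw [h2, h3]; apply le_of_eq; field_simp; ring
  · refine mul_le_mul_of_nonneg_left (le_of_eq ?_) (sq_nonneg _)
    push_cast
    field_simp
    ring

theorem sum_range_sq_cast (n : ℕ) :
    ∑ k ∈ range n, (k : ℝ) ^ 2 = n * (n - 1) * (2 * n - 1) / 6 := by
  induction n with
  | zero => simp
  | succ n ih => rw [sum_range_succ, ih]; push_cast; ring

/-- In units of `sin θ ^ 2`, the plateau contributes about `n` and the slope about `4 (n / 3 + n)`,
together `19 n / 3 < 6.6 n`. -/
theorem kernelCoeff_sum_le {n : ℕ} (hn : 2 ≤ n) (θ : ℝ) :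
    sin θ ^ 2 * ∑ j ∈ range (2 * n), kernelCoeff n θ j ^ 2 +
      (((kernelCoeff n θ (0 + 1) - kernelCoeff n θ (0 - 1)) / 2) ^ 2 +
      ∑ m ∈ range (2 * n + 1),
        ((kernelCoeff n θ (m + 1) - kernelCoeff n θ (m - 1)) / 2) ^ 2) ≤
      sin θ ^ 2 * (6.6 * n) := by
  have hn0 : 0 < n := by omega
  have hn' : (2 : ℝ) ≤ n := by exact_mod_cast hn
  have h0 : ((kernelCoeff n θ (0 + 1) - kernelCoeff n θ (0 - 1)) / 2) ^ 2 =
      sin θ ^ 2 * (1 / 4) := by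
    simp only [Nat.zero_sub, zero_add, kernelCoeff, taper_of_le hn0 hn0]
    simp
    ring
  have hz : kernelCoeff n θ (2 * n) = 0 := by simp [kernelCoeff, taper_of_ge hn0 le_rfl]
  have h1 : sin θ ^ 2 * ∑ j ∈ range (2 * n), kernelCoeff n θ j ^ 2 =
      ∑ j ∈ range (2 * n + 1), sin θ ^ 2 * kernelCoeff n θ j ^ 2 := by
    rw [mul_sum, sum_range_succ, hz]; simp
  set f : ℕ → ℝ := fun m => sin θ ^ 2 * kernelCoeff n θ m ^ 2 +
      ((kernelCoeff n θ (m + 1) - kernelCoeff n θ (m - 1)) / 2) ^ 2 with hf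
  have h2 : ∑ m ∈ range (2 * n + 1), f m ≤
      ∑ m ∈ range n, f m + ∑ k ∈ range n, f (n + k) + f (2 * n) := by
    rw [sum_range_succ, two_mul, sum_range_add]
  have h3 : ∑ m ∈ range n, f m ≤ sin θ ^ 2 * (n - 3 / 4) := by
    obtain ⟨k, rfl⟩ : ∃ k, n = k + 1 := ⟨n - 1, by omega⟩
    rw [sum_range_succ']
    have e0 : f 0 = sin θ ^ 2 * (1 / 4) := by
      simp only [hf]; rw [h0, kernelCoeff_zero]; ring
    have : ∑ m ∈ range k, f (m + 1) ≤ k • sin θ ^ 2 := by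
      have := sum_le_card_nsmul (range k) (fun m => f (m + 1)) (sin θ ^ 2)
        fun m hm => kernelCoeff_sq_add_le_of_lt hn0 (by have := mem_range.1 hm; omega) θ
      simpa using this
    rw [nsmul_eq_mul] at this
    rw [e0]
    push_cast
    linarith
  have h4 : ∑ k ∈ range n, f (n + k) ≤
      sin θ ^ 2 * (4 * (n * (n - 1) * (2 * n - 1) / 6 / n ^ 2 + n)) := by
    calc ∑ k ∈ range n, f (n + k)
        ≤ ∑ k ∈ range n, sin θ ^ 2 * (4 * ((k : ℝ) ^ 2 / n ^ 2 + 1)) :=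
          sum_le_sum fun k hk => kernelCoeff_sq_add_le_of_add hn0 (mem_range.1 hk) θ
      _ = _ := by
          rw [← mul_sum, ← mul_sum, sum_add_distrib, ← sum_div, sum_range_sq_cast]
          simp
  have h5 := kernelCoeff_sq_add_le_two_mul hn0 θ
  have h6 : (1 / 4 : ℝ) + (n - 3 / 4) + 4 * (n * (n - 1) * (2 * n - 1) / 6 / n ^ 2 + n) +
      (2 + 1 / (2 * n ^ 2)) ≤ 6.6 * n := by
    have e : (n : ℝ) * (n - 1) * (2 * n - 1) / 6 / n ^ 2 = n / 3 - 1 / 2 + 1 / 6 * (1 / n) := by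
      field_simp; ring
    have e2 : 1 / (2 * (n : ℝ) ^ 2) = 1 / 2 * (1 / n) ^ 2 := by field_simp
    have hi : 1 / (n : ℝ) ≤ 1 / 2 := by gcongr
    have hp : 0 < 1 / (n : ℝ) := by positivity
    rw [e, e2]
    nlinarith
  rw [h0, h1, add_left_comm, ← sum_add_distrib]
  have h7 := mul_le_mul_of_nonneg_left h6 (sq_nonneg (sin θ))
  have h5' : f (2 * n) ≤ sin θ ^ 2 * (2 + 1 / (2 * n ^ 2)) := h5
  change sin θ ^ 2 * (1 / 4) + ∑ m ∈ range (2 * n + 1), f m ≤ _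
  linarith

/-- Parseval does not apply directly to the weight `sin θ`, so it is replaced using `2 sin θ₀ sin θ
≤ sin² θ₀ + sin² θ`, sharp at `θ₀`, where the kernel peaks. -/
theorem integral_kernel_sq_mul_sin_le {n : ℕ} (hn : 2 ≤ n) {θ₀ : ℝ} (h : 0 < sin θ₀) :
    ∫ θ in (0 : ℝ)..π, sinSum (kernelCoeff n θ₀) (2 * n) θ ^ 2 * sin θ ≤
      π / 4 * 6.6 * n * sin θ₀ := by
  have hn0 : 0 < n := by omega
  set a := kernelCoeff n θ₀ with ha
  set G := sinSum a (2 * n) with hG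
  have ha0 : a 0 = 0 := kernelCoeff_zero n θ₀
  have i1 := integral_sinSum_sq a ha0 (2 * n)
  have i2 : ∫ θ in (0 : ℝ)..π, (G θ * sin θ) ^ 2 =
      π / 2 * (((a (0 + 1) - a (0 - 1)) / 2) ^ 2 +
        ∑ m ∈ range (2 * n + 1), ((a (m + 1) - a (m - 1)) / 2) ^ 2) := by
    simp_rw [hG, sinSum_mul_sin a (2 * n)
      (fun j hj => by simp [ha, kernelCoeff, taper_of_ge hn0 hj]) ha0]
    exact integral_cosSum_sq (fun m => (a (m + 1) - a (m - 1)) / 2) _ (by omega)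
  have key := kernelCoeff_sum_le hn θ₀
  have hGc : Continuous G := continuous_sinSum _ _
  have step : ∫ θ in (0 : ℝ)..π, G θ ^ 2 * sin θ ≤
      ∫ θ in (0 : ℝ)..π, (1 / (2 * sin θ₀)) * (sin θ₀ ^ 2 * G θ ^ 2 + (G θ * sin θ) ^ 2) := by
    refine intervalIntegral.integral_mono_on pi_pos.le
      (Continuous.intervalIntegrable (by fun_prop) _ _)
      (Continuous.intervalIntegrable (by fun_prop) _ _) fun θ _ => ?_
    rw [one_div, ← div_eq_inv_mul, le_div_iff₀ (by positivity)]
    nlinarith [mul_nonneg (sq_nonneg (G θ)) (sq_nonneg (sin θ₀ - sin θ))]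
  refine step.trans ?_
  rw [intervalIntegral.integral_const_mul, intervalIntegral.integral_add
    (Continuous.intervalIntegrable (by fun_prop) _ _)
    (Continuous.intervalIntegrable (by fun_prop) _ _), intervalIntegral.integral_const_mul,
    i1, i2]
  simp only [← ha] at key
  rw [one_div, ← div_eq_inv_mul, div_le_iff₀ (by positivity)]
  have := mul_le_mul_of_nonneg_left key (by positivity : 0 ≤ π / 2)
  linarith

/-! ### The Christoffel bound. -/

theorem sq_integral_mul_le {u v w : ℝ → ℝ} (hu : Continuous u) (hv : Continuous v)
    (hw : Continuous w) (h : ∀ θ ∈ Set.Icc (0 : ℝ) π, 0 ≤ w θ) :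
    (∫ θ in (0 : ℝ)..π, u θ * v θ * w θ) ^ 2 ≤
      (∫ θ in (0 : ℝ)..π, u θ ^ 2 * w θ) * ∫ θ in (0 : ℝ)..π, v θ ^ 2 * w θ := by
  have := discrim_le_zero (a := ∫ θ in (0 : ℝ)..π, v θ ^ 2 * w θ)
    (b := -(2 * ∫ θ in (0 : ℝ)..π, u θ * v θ * w θ)) (c := ∫ θ in (0 : ℝ)..π, u θ ^ 2 * w θ)
    (fun x => by
      have h0 : 0 ≤ ∫ θ in (0 : ℝ)..π, (x * v θ - u θ) ^ 2 * w θ :=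
        intervalIntegral.integral_nonneg pi_pos.le fun θ hθ =>
          mul_nonneg (sq_nonneg _) (h θ hθ)
      have e : ∀ θ, (x * v θ - u θ) ^ 2 * w θ =
          x * x * (v θ ^ 2 * w θ) - 2 * x * (u θ * v θ * w θ) + u θ ^ 2 * w θ := by
        intro θ; ring
      simp_rw [e] at h0
      rw [intervalIntegral.integral_add (Continuous.intervalIntegrable (by fun_prop) _ _)
        (Continuous.intervalIntegrable (by fun_prop) _ _), intervalIntegral.integral_sub
        (Continuous.intervalIntegrable (by fun_prop) _ _)
        (Continuous.intervalIntegrable (by fun_prop) _ _), intervalIntegral.integral_const_mul,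
        intervalIntegral.integral_const_mul] at h0
      linarith)
  rw [discrim] at this
  nlinarith

/-- A bound for the Christoffel function of the Lebesgue measure on `[-1, 1]`, in the variable
`s = cos θ`. -/
theorem norm_sq_cosPoly_mul_sin_le {n : ℕ} (hn : 2 ≤ n) (A : ℕ → ℂ) {θ₀ : ℝ} (h : 0 < sin θ₀) :
    ‖∑ k ∈ range n, A k * (cos θ₀ : ℂ) ^ k‖ ^ 2 * sin θ₀ ≤
      6.6 / π * n * ∫ θ in (0 : ℝ)..π, ‖∑ k ∈ range n, A k * (cos θ : ℂ) ^ k‖ ^ 2 * sin θ := by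
  have hn0 : 0 < n := by omega
  set G := sinSum (kernelCoeff n θ₀) (2 * n) with hG
  set P : ℝ → ℂ := fun θ => ∑ k ∈ range n, A k * (cos θ : ℂ) ^ k with hP
  have hGc : Continuous G := continuous_sinSum _ _
  have hPc : Continuous P := by fun_prop
  have rep : ∫ θ in (0 : ℝ)..π, P θ * ((sin θ * G θ : ℝ) : ℂ) = (π / 2 * sin θ₀ : ℝ) * P θ₀ := by
    simp only [hP]
    simp_rw [sum_mul]
    rw [intervalIntegral.integral_finsetSum
      (fun i _ => Continuous.intervalIntegrable (by fun_prop) _ _), mul_sum]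
    refine sum_congr rfl fun k hk => ?_
    -- The weight `sin θ` is the case `j = 1`; `k < n` keeps the frequencies on the plateau.
    have := integral_cos_pow_mul_kernel hn0 θ₀ k 1 (by have := mem_range.1 hk; omega)
    simp only [Nat.cast_one, one_mul] at this
    have e : ∀ θ : ℝ, A k * (cos θ : ℂ) ^ k * ((sin θ * G θ : ℝ) : ℂ) =
        A k * ((cos θ ^ k * sin θ * G θ : ℝ) : ℂ) := by
      intro θ; push_cast; ring
    simp_rw [e]
    rw [intervalIntegral.integral_const_mul, intervalIntegral.integral_ofReal, this]
    push_cast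
    ring
  have b1 : π / 2 * sin θ₀ * ‖P θ₀‖ ≤ ∫ θ in (0 : ℝ)..π, ‖P θ‖ * |G θ| * sin θ := by
    calc π / 2 * sin θ₀ * ‖P θ₀‖ = ‖∫ θ in (0 : ℝ)..π, P θ * ((sin θ * G θ : ℝ) : ℂ)‖ := by
          rw [rep, norm_mul, Complex.norm_real, Real.norm_of_nonneg (by positivity)]
      _ ≤ ∫ θ in (0 : ℝ)..π, ‖P θ * ((sin θ * G θ : ℝ) : ℂ)‖ :=
          intervalIntegral.norm_integral_le_integral_norm pi_pos.le
      _ = _ := by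
          refine intervalIntegral.integral_congr fun θ hθ => ?_
          rw [Set.uIcc_of_le pi_pos.le] at hθ
          simp only [norm_mul, Complex.norm_real, Real.norm_eq_abs,
            abs_of_nonneg (sin_nonneg_of_mem_Icc hθ)]
          ring
  have b2 := sq_integral_mul_le (u := fun θ => ‖P θ‖) (v := fun θ => |G θ|) (w := sin)
    (by fun_prop) (by fun_prop) (by fun_prop) fun θ hθ => sin_nonneg_of_mem_Icc hθ
  simp only [sq_abs] at b2
  have b3 := integral_kernel_sq_mul_sin_le hn h
  set X := ∫ θ in (0 : ℝ)..π, ‖P θ‖ ^ 2 * sin θ with hX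
  have hX0 : 0 ≤ X := intervalIntegral.integral_nonneg pi_pos.le fun θ hθ =>
    mul_nonneg (sq_nonneg _) (sin_nonneg_of_mem_Icc hθ)
  have b4 : (π / 2 * sin θ₀ * ‖P θ₀‖) ^ 2 ≤ X * (π / 4 * 6.6 * n * sin θ₀) :=
    (pow_le_pow_left₀ (by positivity) b1 2).trans
      (b2.trans (mul_le_mul_of_nonneg_left b3 hX0))
  have hpos : 0 < π ^ 2 / 4 * sin θ₀ := by positivity
  refine le_of_mul_le_mul_left ?_ hpos
  calc π ^ 2 / 4 * sin θ₀ * (‖P θ₀‖ ^ 2 * sin θ₀) = (π / 2 * sin θ₀ * ‖P θ₀‖) ^ 2 := by ring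
    _ ≤ _ := b4
    _ = π ^ 2 / 4 * sin θ₀ * (6.6 / π * n * X) := by field_simp

end FourierFit

namespace FourierFit

/-! ### The uniform measure -/

theorem isProbabilityMeasure_unif {a b : ℝ} (h : a < b) : IsProbabilityMeasure (unif a b) :=
  ProbabilityTheory.cond_isProbabilityMeasure_of_finite (by simp [h]) (by simp)

theorem ae_unif_mem (a b : ℝ) : ∀ᵐ x ∂(unif a b), x ∈ Set.Icc a b :=
  ProbabilityTheory.ae_cond_mem measurableSet_Icc

theorem unif_eq_smul {a b : ℝ} (h : a < b) :
    unif a b = ENNReal.ofReal (1 / (b - a)) • volume.restrict (Set.Icc a b) := by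
  rw [unif, ProbabilityTheory.cond, Real.volume_Icc, one_div,
    ENNReal.ofReal_inv_of_pos (sub_pos.2 h)]

theorem integral_unif {a b : ℝ} (h : a < b) (f : ℝ → ℝ) :
    ∫ x, f x ∂(unif a b) = 1 / (b - a) * ∫ x in a..b, f x := by
  rw [unif_eq_smul h, integral_smul_measure, intervalIntegral.integral_of_le h.le,
    integral_Icc_eq_integral_Ioc, ENNReal.toReal_ofReal (by simpa using h.le), smul_eq_mul]

theorem norm_Lp_sq_eq_integral {ν : Measure ℝ} (f : Lp ℂ 2 ν) : ‖f‖ ^ 2 = ∫ x, ‖f x‖ ^ 2 ∂ν := by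
  have h : (⟪f, f⟫_ℂ) = ((∫ x, ‖f x‖ ^ 2 ∂ν : ℝ) : ℂ) := by
    rw [L2.inner_def, ← integral_complex_ofReal]
    refine integral_congr_ae (Filter.Eventually.of_forall fun x => ?_)
    simp only [inner_self_eq_norm_sq_to_K]
    simp
  rw [inner_self_eq_norm_sq_to_K] at h
  apply Complex.ofReal_injective
  rw [← h]
  simp

theorem integral_norm_le_norm_Lp {ν : Measure ℝ} [IsProbabilityMeasure ν] (f : Lp ℂ 2 ν) :
    ∫ x, ‖f x‖ ∂ν ≤ ‖f‖ := by
  rw [integral_norm_eq_lintegral_enorm (Lp.aestronglyMeasurable f),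
    ← eLpNorm_one_eq_lintegral_enorm, Lp.norm_def]
  exact ENNReal.toReal_mono (Lp.memLp f).eLpNorm_ne_top
    (eLpNorm_le_eLpNorm_of_exponent_le one_le_two (Lp.aestronglyMeasurable f))

@[fun_prop]
theorem continuous_expIntegral (σ : ℝ) (ν : Measure ℝ) [IsFiniteMeasure ν] (f : Lp ℂ 2 ν) :
    Continuous (expIntegral σ ν f) := by
  have hf : Integrable f ν := (Lp.memLp f).integrable (by norm_num)
  refine continuous_of_dominated (bound := fun x => ‖f x‖)
    (fun s => (integrable_exp_mul σ ν f s).aestronglyMeasurable)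
    (fun s => Filter.Eventually.of_forall fun x => ?_) hf.norm
    (Filter.Eventually.of_forall fun x => by fun_prop)
  rw [norm_mul, norm_exp_char, mul_one]

theorem coeFn_expOp (σ : ℝ) (ν ρ : Measure ℝ) [IsFiniteMeasure ν] [IsFiniteMeasure ρ]
    (f : Lp ℂ 2 ν) : expOp σ ν ρ f =ᵐ[ρ] expIntegral σ ν f :=
  (memLp_expIntegral σ ν ρ f).coeFn_toLp

theorem integral_comp_cos_mul_sin {T : ℝ} {g : ℝ → ℝ} (hg : Continuous g) :
    ∫ θ in (0 : ℝ)..Real.pi, g (T / 2 * (1 - Real.cos θ)) * Real.sin θ * (T / 2) =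
      ∫ t in (0 : ℝ)..T, g t := by
  have h := intervalIntegral.integral_comp_mul_deriv (a := 0) (b := Real.pi) (g := g)
    (f := fun θ => T / 2 * (1 - Real.cos θ)) (f' := fun θ => T / 2 * Real.sin θ)
    (fun θ _ => by
      have := ((Real.hasDerivAt_cos θ).const_sub 1).const_mul (T / 2)
      simpa using this) (Continuous.continuousOn (by fun_prop)) hg
  simp only [Real.cos_zero, Real.cos_pi, sub_self, mul_zero, Function.comp] at h
  rw [show T / 2 * (1 - -1) = T by ring] at h
  rw [← h]
  refine intervalIntegral.integral_congr fun θ _ => ?_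
  ring

theorem norm_invFourier_sq_eq_integral (μ : Measure ℝ) [IsFiniteMeasure μ] (T : ℝ)
    (α : Lp ℂ 2 μ) :
    ‖invFourier μ T α‖ ^ 2 = ∫ t, ‖expIntegral 1 μ α t‖ ^ 2 ∂(unif 0 T) := by
  rw [norm_Lp_sq_eq_integral]
  refine integral_congr_ae ?_
  filter_upwards [coeFn_expOp 1 μ (unif 0 T) α] with t ht
  rw [invFourier, ht]

/-- The substitution `t = T / 2 (1 - cos θ)` turns the uniform measure into `sin θ dθ / 2`, the
weight of the Christoffel bound. -/
theorem norm_invFourier_sq {μ : Measure ℝ} [IsFiniteMeasure μ] {T : ℝ} (hT : 0 < T)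
    (α : Lp ℂ 2 μ) :
    2 * ‖invFourier μ T α‖ ^ 2 = ∫ θ in (0 : ℝ)..Real.pi,
      ‖expIntegral 1 μ α (T / 2 * (1 - Real.cos θ))‖ ^ 2 * Real.sin θ := by
  rw [norm_invFourier_sq_eq_integral, integral_unif hT, ← integral_comp_cos_mul_sin (by fun_prop),
    intervalIntegral.integral_mul_const]
  simp only [sub_zero]
  field_simp

/-! ### Approximation of band limited functions by polynomials -/

/-- The tail is at most twice its first term, and `nⁿ / n! ≤ eⁿ` bounds that term by `(e y / n)ⁿ ≤
4⁻ⁿ`. -/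
theorem norm_exp_sub_taylor_le {x : ℂ} {y : ℝ} {n : ℕ} (hx : ‖x‖ ≤ y)
    (hn : 4 * Real.exp 1 * y ≤ n) :
    ‖Complex.exp x - ∑ m ∈ Finset.range n, x ^ m / m.factorial‖ ≤ 2 * (1 / 4) ^ n := by
  have hy : 0 ≤ y := (norm_nonneg x).trans hx
  have he : 1 ≤ Real.exp 1 := Real.one_le_exp zero_le_one
  have h1 : ‖x‖ / (n.succ : ℝ) ≤ 1 / 2 := by
    rw [div_le_iff₀ (by positivity)]
    push_cast
    nlinarith
  refine (Complex.exp_bound' h1).trans ?_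
  have h2 : (4 * Real.exp 1 * y) ^ n ≤ (n : ℝ) ^ n := by gcongr
  have h3 := Real.pow_div_factorial_le_exp (x := n) (Nat.cast_nonneg n) n
  have h4 : Real.exp n = Real.exp 1 ^ n := by rw [← Real.exp_nat_mul, mul_one]
  rw [div_le_iff₀ (by positivity), h4] at h3
  rw [mul_pow, mul_pow] at h2
  have h5 : 4 ^ n * y ^ n ≤ (n.factorial : ℝ) := by
    refine le_of_mul_le_mul_left ?_ (by positivity : 0 < Real.exp 1 ^ n)
    calc Real.exp 1 ^ n * (4 ^ n * y ^ n) = 4 ^ n * Real.exp 1 ^ n * y ^ n := by ring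
      _ ≤ _ := h2.trans h3
  have h6 : ‖x‖ ^ n / n.factorial ≤ (1 / 4) ^ n := by
    rw [div_le_iff₀ (by positivity), one_div, inv_pow, ← div_eq_inv_mul,
      le_div_iff₀ (by positivity)]
    calc ‖x‖ ^ n * 4 ^ n ≤ y ^ n * 4 ^ n := by gcongr
      _ ≤ _ := by linarith
  linarith

/-- Removing the midpoint phase `E ξ` leaves `exp (w ξ cos θ)` with `‖w ξ‖ ≤ π F T`. Its Taylor
polynomial, integrated against `α`, is the polynomial in `cos θ`. -/
theorem exists_cosPoly_near {F T : ℝ} (hF : 0 < F) (hT : 0 < T) {n : ℕ}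
    (hn : 4 * Real.exp 1 * (Real.pi * F * T) ≤ n) (α : Lp ℂ 2 (unif (-F) F)) :
    ∃ A : ℕ → ℂ, ∀ θ : ℝ,
      ‖expIntegral 1 (unif (-F) F) α (T / 2 * (1 - Real.cos θ)) -
        ∑ k ∈ Finset.range n, A k * (Real.cos θ : ℂ) ^ k‖ ≤ 2 * (1 / 4) ^ n * ‖α‖ := by
  have := isProbabilityMeasure_unif (show -F < F by linarith)
  have hα : Integrable α (unif (-F) F) := (Lp.memLp α).integrable (by norm_num)
  have hξ : ∀ᵐ ξ ∂(unif (-F) F), |ξ| ≤ F := by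
    filter_upwards [ae_unif_mem (-F) F] with ξ h
    exact abs_le.2 h
  set E : ℝ → ℂ := fun ξ => Complex.exp ((Real.pi * ξ * T : ℝ) * Complex.I) with hE
  have hEn : ∀ ξ, ‖E ξ‖ = 1 := fun ξ => Complex.norm_exp_ofReal_mul_I _
  set w : ℝ → ℂ := fun ξ => -((Real.pi * ξ * T : ℝ) * Complex.I) with hw
  have hwn : ∀ ξ, |ξ| ≤ F → ‖w ξ‖ ≤ Real.pi * F * T := by
    intro ξ h
    rw [hw]
    simp only [norm_neg, norm_mul, Complex.norm_real, Complex.norm_I, mul_one, Real.norm_eq_abs,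
      abs_of_pos hT, abs_of_pos Real.pi_pos]
    gcongr
  have hint : ∀ k : ℕ, Integrable (fun ξ => α ξ * (E ξ * (w ξ ^ k / k.factorial))) (unif (-F) F) := by
    intro k
    refine hα.mul_bdd (c := (Real.pi * F * T) ^ k / k.factorial)
      (Continuous.aestronglyMeasurable (by fun_prop)) ?_
    filter_upwards [hξ] with ξ h
    rw [norm_mul, hEn, one_mul, norm_div, norm_pow, Complex.norm_natCast]
    gcongr
    exact hwn ξ h
  refine ⟨fun k => ∫ ξ, α ξ * (E ξ * (w ξ ^ k / k.factorial)) ∂(unif (-F) F), fun θ => ?_⟩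
  have h1 : ∑ k ∈ Finset.range n, (∫ ξ, α ξ * (E ξ * (w ξ ^ k / k.factorial)) ∂(unif (-F) F)) *
      (Real.cos θ : ℂ) ^ k =
      ∫ ξ, ∑ k ∈ Finset.range n, α ξ * (E ξ * (w ξ ^ k / k.factorial)) *
        (Real.cos θ : ℂ) ^ k ∂(unif (-F) F) := by
    rw [integral_finsetSum _ fun k _ => (hint k).mul_const _]
    exact Finset.sum_congr rfl fun k _ => (integral_mul_const _ _).symm
  rw [h1, expIntegral, ← integral_sub (integrable_exp_mul _ _ _ _)
    (integrable_finsetSum _ fun k _ => (hint k).mul_const _)]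
  calc _ ≤ ∫ ξ, 2 * (1 / 4) ^ n * ‖α ξ‖ ∂(unif (-F) F) := by
        refine norm_integral_le_of_norm_le (hα.norm.const_mul _) ?_
        filter_upwards [hξ] with ξ h
        have e1 : Complex.exp (2 * Real.pi * Complex.I * (1 : ℝ) * ξ *
            (T / 2 * (1 - Real.cos θ) : ℝ)) = E ξ * Complex.exp (w ξ * Real.cos θ) := by
          rw [hE, hw]
          simp only []
          rw [← Complex.exp_add]
          congr 1
          push_cast
          ring
        have e2 : ∑ k ∈ Finset.range n,
            α ξ * (E ξ * (w ξ ^ k / k.factorial)) * (Real.cos θ : ℂ) ^ k =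
            α ξ * (E ξ * ∑ k ∈ Finset.range n, (w ξ * Real.cos θ) ^ k / k.factorial) := by
          rw [Finset.mul_sum, Finset.mul_sum]
          refine Finset.sum_congr rfl fun k _ => ?_
          rw [mul_pow]
          ring
        rw [e1, e2, ← mul_sub, ← mul_sub, norm_mul, norm_mul, hEn, one_mul, mul_comm]
        refine mul_le_mul_of_nonneg_right (norm_exp_sub_taylor_le (y := Real.pi * F * T) ?_ hn)
          (norm_nonneg _)
        rw [norm_mul, Complex.norm_real, Real.norm_eq_abs]
        calc ‖w ξ‖ * |Real.cos θ| ≤ Real.pi * F * T * 1 :=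
              mul_le_mul (hwn ξ h) (Real.abs_cos_le_one θ) (abs_nonneg _) (by positivity)
          _ = _ := mul_one _
    _ ≤ _ := by
        rw [integral_const_mul]
        gcongr
        exact integral_norm_le_norm_Lp α

/-- `16 > 2 e²` leaves a factor `2ⁿ ≥ 4` beyond `e^(2n) ≥ e⁴ / ε`, and `e⁴ > 50`. -/
theorem sq_taylor_error_le {ε : ℝ} (hε : 0 < ε) {n : ℕ}
    (hn2 : 2 ≤ n) (hn : Real.log (1 / ε) / 2 + 2 ≤ n) :
    (2 * (1 / 4 : ℝ) ^ n) ^ 2 ≤ ε / 50 := by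
  have he := Real.exp_one_lt_d9
  have he' := Real.exp_one_gt_d9
  have h1 : (2 * Real.exp 1 ^ 2) ^ n ≤ (16 : ℝ) ^ n := by
    gcongr
    nlinarith [Real.exp_pos 1]
  have h2 : (4 : ℝ) ≤ 2 ^ n := by
    calc (4 : ℝ) = 2 ^ 2 := by norm_num
      _ ≤ 2 ^ n := pow_le_pow_right₀ (by norm_num) hn2
  have h3 : 1 / ε * 50 ≤ (Real.exp 1 ^ 2) ^ n := by
    calc 1 / ε * 50 ≤ 1 / ε * Real.exp 1 ^ 4 := by
          gcongr
          calc (50 : ℝ) ≤ 2.7 ^ 4 := by norm_num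
            _ ≤ _ := by gcongr; linarith
      _ = Real.exp (Real.log (1 / ε) + 4) := by
          rw [Real.exp_add, Real.exp_log (by positivity), ← Real.exp_nat_mul]
          norm_num
      _ ≤ Real.exp (n * 2) := Real.exp_le_exp.2 (by linarith)
      _ = _ := by
          rw [← pow_mul, ← Real.exp_nat_mul]
          congr 1
          push_cast
          ring
  have h4 : 4 * (1 / ε * 50) ≤ (16 : ℝ) ^ n := by
    refine le_trans ?_ h1
    rw [mul_pow]
    gcongr
  have h5 : (2 * (1 / 4 : ℝ) ^ n) ^ 2 = 4 / 16 ^ n := by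
    rw [mul_pow, ← pow_mul, mul_comm n, pow_mul]
    norm_num only [div_pow, one_pow]
    rw [← div_eq_mul_one_div]
  rw [h5, div_le_iff₀ (by positivity)]
  calc (4 : ℝ) = ε / 50 * (4 * (1 / ε * 50)) := by field_simp
    _ ≤ _ := by gcongr

/-- The `11` in the degree is `4 · 2 + 3`, where `3` is the most that rounding `q / 4` down can
lose. -/
theorem bandDegree_div_four {F T ε : ℝ} (hF : 0 < F) (hT : 0 < T) (hε : 0 < ε) (hε1 : ε ≤ 1) :
    2 ≤ bandDegree F T ε / 4 ∧
      4 * Real.exp 1 * (Real.pi * F * T) ≤ (bandDegree F T ε / 4 : ℕ) ∧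
      Real.log (1 / ε) / 2 + 2 ≤ (bandDegree F T ε / 4 : ℕ) := by
  have hl : 0 ≤ Real.log (1 / ε) := Real.log_nonneg (by rw [le_div_iff₀ hε]; linarith)
  have hA : 0 < Real.pi * Real.exp 1 * F * T := by positivity
  have hq : 16 * Real.pi * Real.exp 1 * F * T + 2 * Real.log (1 / ε) + 11 ≤ bandDegree F T ε :=
    Nat.le_ceil _
  set q := bandDegree F T ε
  have h4 : (q : ℝ) ≤ 4 * (q / 4 : ℕ) + 3 := by
    have : q ≤ 4 * (q / 4) + 3 := by omega
    exact_mod_cast this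
  refine ⟨?_, ?_, ?_⟩
  · have : (2 : ℝ) ≤ (q / 4 : ℕ) := by nlinarith
    exact_mod_cast this
  · nlinarith
  · nlinarith

/-! ### The pointwise leverage bound. -/

theorem norm_add_sq_le_weighted (x y : ℂ) : ‖x‖ ^ 2 ≤ 9 / 8 * ‖y‖ ^ 2 + 9 * ‖x - y‖ ^ 2 := by
  have h : ‖x‖ ≤ ‖y‖ + ‖x - y‖ := by
    calc ‖x‖ = ‖y + (x - y)‖ := by rw [add_sub_cancel]
      _ ≤ _ := norm_add_le _ _
  have h2 : ‖x‖ ^ 2 ≤ (‖y‖ + ‖x - y‖) ^ 2 := by gcongr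
  nlinarith [sq_nonneg (‖y‖ - 8 * ‖x - y‖)]

/-- With `u = t / T`, `sin² θ = 4 u (1 - u)`, and the larger of `u` and `1 - u` is at least `1 / 2`.
-/
theorem two_mul_min_le_sin_sq {T t θ : ℝ} (hT : 0 < T) (ht : t ∈ Set.Ioo 0 T)
    (h : Real.cos θ = 1 - 2 * (t / T)) : 2 * (min t (T - t) / T) ≤ Real.sin θ ^ 2 := by
  have hu : 0 < t / T := div_pos ht.1 hT
  have hu1 : t / T < 1 := (div_lt_one hT).2 ht.2
  have e : min t (T - t) / T = min (t / T) (1 - t / T) := by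
    rw [← min_div_div_right hT.le, sub_div, div_self hT.ne']
  rw [Real.sin_sq, h, e]
  rcases le_total (t / T) (1 - t / T) with h1 | h1
  · rw [min_eq_left h1]; nlinarith
  · rw [min_eq_right h1]; nlinarith

/-- The pointwise bound for band limited functions. -/
theorem norm_sq_expIntegral_le {F T ε : ℝ} (hF : 0 < F) (hT : 0 < T) (hε : 0 < ε) (hε1 : ε ≤ 1)
    {t : ℝ} (ht : t ∈ Set.Ioo 0 T) (α : Lp ℂ 2 (unif (-F) F)) :
    ‖expIntegral 1 (unif (-F) F) α t‖ ^ 2 ≤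
      (4 + bandDegree F T ε / Real.sqrt (min t (T - t) / T)) *
        (‖invFourier (unif (-F) F) T α‖ ^ 2 + ε * ‖α‖ ^ 2) := by
  obtain ⟨hn2, hn4, hnl⟩ := bandDegree_div_four hF hT hε hε1
  have hqn : ((4 * (bandDegree F T ε / 4) : ℕ) : ℝ) ≤ bandDegree F T ε :=
    Nat.cast_le.2 (Nat.mul_div_le _ _)
  push_cast only [Nat.cast_mul, Nat.cast_ofNat] at hqn
  set n := bandDegree F T ε / 4
  set q : ℝ := (bandDegree F T ε : ℝ)
  obtain ⟨A, hA⟩ := exists_cosPoly_near hF hT hn4 α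
  have hδ := sq_taylor_error_le hε hn2 hnl
  set δ : ℝ := 2 * (1 / 4) ^ n
  set x := min t (T - t) / T with hx
  have hx0 : 0 < x := div_pos (lt_min ht.1 (by linarith [ht.2])) hT
  have hu : 0 < t / T := div_pos ht.1 hT
  have hu1 : t / T < 1 := (div_lt_one hT).2 ht.2
  obtain ⟨θ₀, hθ, hc⟩ : ∃ θ₀, 0 < Real.sin θ₀ ∧ Real.cos θ₀ = 1 - 2 * (t / T) := by
    refine ⟨Real.arccos (1 - 2 * (t / T)), ?_, Real.cos_arccos (by linarith) (by linarith)⟩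
    rw [Real.sin_arccos]
    exact Real.sqrt_pos.2 (by nlinarith)
  have hs := two_mul_min_le_sin_sq hT ht hc
  rw [← hx] at hs
  have htθ : T / 2 * (1 - Real.cos θ₀) = t := by rw [hc]; field_simp; ring
  set P : ℝ → ℂ := fun θ => ∑ k ∈ Finset.range n, A k * (Real.cos θ : ℂ) ^ k with hP
  set Z : ℝ → ℂ := fun θ => expIntegral 1 (unif (-F) F) α (T / 2 * (1 - Real.cos θ)) with hZ
  have hPc : Continuous P := by fun_prop
  have hZc : Continuous Z := by fun_prop
  have hA' : ∀ θ, ‖Z θ - P θ‖ ^ 2 ≤ δ ^ 2 * ‖α‖ ^ 2 := by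
    intro θ
    rw [← mul_pow]
    exact pow_le_pow_left₀ (norm_nonneg _) (hA θ) 2
  have hPi := norm_sq_cosPoly_mul_sin_le hn2 A hθ
  change ‖P θ₀‖ ^ 2 * Real.sin θ₀ ≤
    6.6 / Real.pi * n * ∫ θ in (0 : ℝ)..Real.pi, ‖P θ‖ ^ 2 * Real.sin θ at hPi
  have hN := norm_invFourier_sq hT α
  change 2 * ‖invFourier (unif (-F) F) T α‖ ^ 2 =
    ∫ θ in (0 : ℝ)..Real.pi, ‖Z θ‖ ^ 2 * Real.sin θ at hN
  set N := ‖invFourier (unif (-F) F) T α‖ ^ 2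
  have hI : ∫ θ in (0 : ℝ)..Real.pi, ‖P θ‖ ^ 2 * Real.sin θ ≤
      9 / 4 * N + 18 * (δ ^ 2 * ‖α‖ ^ 2) := by
    calc ∫ θ in (0 : ℝ)..Real.pi, ‖P θ‖ ^ 2 * Real.sin θ
        ≤ ∫ θ in (0 : ℝ)..Real.pi, (9 / 8 * (‖Z θ‖ ^ 2 * Real.sin θ) +
            9 * (δ ^ 2 * ‖α‖ ^ 2) * Real.sin θ) := by
          refine intervalIntegral.integral_mono_on Real.pi_pos.le
            (Continuous.intervalIntegrable (by fun_prop) _ _)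
            (Continuous.intervalIntegrable (by fun_prop) _ _) fun θ h => ?_
          have h1 := norm_add_sq_le_weighted (P θ) (Z θ)
          rw [norm_sub_rev] at h1
          have h2 := Real.sin_nonneg_of_mem_Icc h
          have h3 := hA' θ
          calc ‖P θ‖ ^ 2 * Real.sin θ
              ≤ (9 / 8 * ‖Z θ‖ ^ 2 + 9 * (δ ^ 2 * ‖α‖ ^ 2)) * Real.sin θ := by gcongr; linarith
            _ = _ := by ring
      _ = _ := by
          rw [intervalIntegral.integral_add
            (Continuous.intervalIntegrable (by fun_prop) _ _)
            (Continuous.intervalIntegrable (by fun_prop) _ _),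
            intervalIntegral.integral_const_mul, intervalIntegral.integral_const_mul, ← hN,
            integral_sin]
          simp
          ring
  have hz := norm_add_sq_le_weighted (Z θ₀) (P θ₀)
  rw [show Z θ₀ = expIntegral 1 (unif (-F) F) α t by rw [hZ]; simp only [htθ]] at hz
  have hA0 := hA' θ₀
  rw [show Z θ₀ = expIntegral 1 (unif (-F) F) α t by rw [hZ]; simp only [htθ]] at hA0
  have hr0 : 0 < Real.sqrt x := Real.sqrt_pos.2 hx0
  -- `1.4142` is a rational lower bound for `√2`; below, `1.486 * 1.4142` just exceeds `6.6 / π`.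
  have hr : 1.4142 * Real.sqrt x ≤ Real.sin θ₀ := by
    refine abs_le_of_sq_le_sq' ?_ hθ.le |>.2
    rw [mul_pow, Real.sq_sqrt hx0.le]
    linarith
  have hP0 : ‖P θ₀‖ ^ 2 * Real.sqrt x ≤ 1.486 * n * (9 / 4 * N + 18 * (δ ^ 2 * ‖α‖ ^ 2)) := by
    have h1 : ‖P θ₀‖ ^ 2 * (1.4142 * Real.sqrt x) ≤
        6.6 / Real.pi * n * (9 / 4 * N + 18 * (δ ^ 2 * ‖α‖ ^ 2)) := by
      refine (mul_le_mul_of_nonneg_left hr (sq_nonneg _)).trans (hPi.trans ?_)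
      gcongr
    have h2 : 6.6 / Real.pi ≤ 1.486 * 1.4142 := by
      rw [div_le_iff₀ Real.pi_pos]
      nlinarith [Real.pi_gt_d4]
    have h3 : 0 ≤ n * (9 / 4 * N + 18 * (δ ^ 2 * ‖α‖ ^ 2)) := by positivity
    nlinarith [mul_le_mul_of_nonneg_right h2 h3]
  have hP1 : ‖P θ₀‖ ^ 2 ≤
      1.486 * (n / Real.sqrt x) * (9 / 4 * N + 18 * (δ ^ 2 * ‖α‖ ^ 2)) := by
    rw [← le_div_iff₀ hr0] at hP0
    refine hP0.trans (le_of_eq ?_)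
    ring
  have hnq : 4 * (n / Real.sqrt x) ≤ q / Real.sqrt x := by
    rw [← mul_div_assoc]
    gcongr
  have hda : δ ^ 2 * ‖α‖ ^ 2 ≤ ε / 50 * ‖α‖ ^ 2 := by gcongr
  have hN0 : 0 ≤ N := sq_nonneg _
  have hy0 : 0 ≤ n / Real.sqrt x := by positivity
  set y := n / Real.sqrt x
  set a := ‖α‖ ^ 2
  have ha0 : 0 ≤ a := sq_nonneg _
  calc ‖expIntegral 1 (unif (-F) F) α t‖ ^ 2
      ≤ 9 / 8 * (1.486 * y * (9 / 4 * N + 18 * (ε / 50 * a))) + 9 * (ε / 50 * a) := by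
        refine hz.trans ?_
        have : 1.486 * y * (9 / 4 * N + 18 * (δ ^ 2 * a)) ≤
            1.486 * y * (9 / 4 * N + 18 * (ε / 50 * a)) := by gcongr
        linarith
    -- The tight coefficient is that of `y * N`: `9/8 * 1.486 * 9/4 < 3.77`.
    _ ≤ (4 + 4 * y) * (N + ε * a) := by
        have h1 : 0 ≤ y * N := by positivity
        have h2 : 0 ≤ y * (ε * a) := by positivity
        have h3 : 0 ≤ ε * a := by positivity
        nlinarith
    _ ≤ _ := by gcongr

theorem approxLeverage_eq_ofReal {F T ε t : ℝ} (hT : 0 < T) (ht : t ∈ Set.Ioo 0 T) :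
    approxLeverage F T ε t = ENNReal.ofReal (1 / T) *
      ENNReal.ofReal (4 + bandDegree F T ε / Real.sqrt (min t (T - t) / T)) := by
  have hx0 : 0 < min t (T - t) / T := div_pos (lt_min ht.1 (by linarith [ht.2])) hT
  have hr0 := Real.sqrt_pos.2 hx0
  rw [approxLeverage, ENNReal.ofReal_add (by norm_num) (by positivity),
    ENNReal.ofReal_div_of_pos hr0, ENNReal.ofReal_natCast, ENNReal.ofReal_ofNat]

theorem bandDegree_pos {F T ε : ℝ} (hF : 0 < F) (hT : 0 < T) (hε : 0 < ε) (hε1 : ε ≤ 1) :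
    0 < bandDegree F T ε := by
  have := (bandDegree_div_four hF hT hε hε1).1
  omega

theorem leverage_le_approxLeverage {F T ε : ℝ} (hF : 0 < F) (hT : 0 < T) (hε : 0 < ε)
    (hε1 : ε ≤ 1) {t : ℝ} (ht : t ∈ Set.Icc 0 T) :
    leverage (unif (-F) F) T ε t ≤ approxLeverage F T ε t := by
  by_cases h : t ∈ Set.Ioo 0 T
  · rw [approxLeverage_eq_ofReal hT h, leverage]
    gcongr
    refine iSup₂_le fun α hα => ?_
    have hr : 0 ≤ bandDegree F T ε / Real.sqrt (min t (T - t) / T) := by positivity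
    refine ENNReal.div_le_of_le_mul ?_
    rw [← ENNReal.ofReal_mul (by linarith)]
    exact ENNReal.ofReal_le_ofReal (norm_sq_expIntegral_le hF hT hε hε1 h α)
  · have hm : min t (T - t) = 0 := by
      rcases ht.1.eq_or_lt with h0 | h0
      · rw [← h0]; simp [hT.le]
      · have : t = T := by
          by_contra hne
          exact h ⟨h0, lt_of_le_of_ne ht.2 hne⟩
        rw [this]; simp [hT.le]
    -- Needed because `0 / 0 = 0` in `ℝ≥0∞`; a positive degree makes the end point value `∞`.
    have hq : (bandDegree F T ε : ℝ≥0∞) ≠ 0 := by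
      exact_mod_cast (bandDegree_pos hF hT hε hε1).ne'
    have hT' : ENNReal.ofReal (1 / T) ≠ 0 := by simp [hT]
    rw [approxLeverage, hm]
    simp only [zero_div, Real.sqrt_zero, ENNReal.ofReal_zero]
    rw [ENNReal.div_zero hq, add_top, ENNReal.mul_top hT']
    exact le_top

end FourierFit

namespace FourierFit

/-! ### The mass of the approximate leverage function -/

theorem integral_rpow_neg_half {T : ℝ} :
    ∫ t in (0 : ℝ)..T, t ^ (-(1 / 2) : ℝ) = 2 * T ^ (1 / 2 : ℝ) := by
  rw [integral_rpow (Or.inl (by norm_num))]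
  norm_num
  ring

theorem intervalIntegrable_rpow_neg_half (a b : ℝ) :
    IntervalIntegrable (fun t : ℝ => t ^ (-(1 / 2) : ℝ)) volume a b :=
  intervalIntegral.intervalIntegrable_rpow' (by norm_num)

/-- The minimum is one of its arguments; adding both terms avoids splitting the integral at `T / 2`.
-/
theorem inv_sqrt_min_le {T t : ℝ} (hT : 0 < T) (ht : t ∈ Set.Ioo 0 T) :
    1 / Real.sqrt (min t (T - t) / T) ≤
      Real.sqrt T * (t ^ (-(1 / 2) : ℝ) + (T - t) ^ (-(1 / 2) : ℝ)) := by
  have h0 : 0 < T - t := by linarith [ht.2]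
  have h1 : ∀ x : ℝ, 0 < x → x ^ (-(1 / 2) : ℝ) = 1 / Real.sqrt x := by
    intro x hx
    rw [Real.rpow_neg hx.le, ← Real.sqrt_eq_rpow, one_div]
  rw [h1 t ht.1, h1 _ h0, Real.sqrt_div (le_min ht.1.le h0.le), one_div_div, div_eq_mul_one_div]
  gcongr
  rcases min_choice t (T - t) with h | h
  · rw [h]; exact le_add_of_nonneg_right (by positivity)
  · rw [h]; exact le_add_of_nonneg_left (by positivity)

theorem approxStatDim_le {F T ε : ℝ} (hT : 0 < T) :
    approxStatDim F T ε ≤ ENNReal.ofReal (4 + 4 * bandDegree F T ε) := by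
  set q : ℝ := (bandDegree F T ε : ℝ) with hq
  have hq0 : 0 ≤ q := Nat.cast_nonneg _
  set g : ℝ → ℝ := fun t => 1 / T * (4 + q * (Real.sqrt T *
    (t ^ (-(1 / 2) : ℝ) + (T - t) ^ (-(1 / 2) : ℝ)))) with hg
  have i1 := intervalIntegrable_rpow_neg_half 0 T
  have i2 : IntervalIntegrable (fun t : ℝ => (T - t) ^ (-(1 / 2) : ℝ)) volume 0 T := by
    have := (intervalIntegrable_rpow_neg_half T 0).comp_sub_left T
    simpa using this
  have i3 : IntervalIntegrable
      (fun t => q * (Real.sqrt T * (t ^ (-(1 / 2) : ℝ) + (T - t) ^ (-(1 / 2) : ℝ)))) volume 0 T :=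
    ((i1.add i2).const_mul _).const_mul _
  have hgi : IntervalIntegrable g volume 0 T := (intervalIntegrable_const.add i3).const_mul _
  have hI : ∫ t in (0 : ℝ)..T, g t = 4 + 4 * q := by
    have e : ∫ t in (0 : ℝ)..T, (T - t) ^ (-(1 / 2) : ℝ) = 2 * T ^ (1 / 2 : ℝ) := by
      rw [intervalIntegral.integral_comp_sub_left (fun x => x ^ (-(1 / 2) : ℝ)), sub_self,
        sub_zero, integral_rpow_neg_half]
    rw [hg, intervalIntegral.integral_const_mul, intervalIntegral.integral_add
      intervalIntegrable_const i3, intervalIntegral.integral_const_mul,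
      intervalIntegral.integral_const_mul, intervalIntegral.integral_add i1 i2, e,
      integral_rpow_neg_half, ← Real.sqrt_eq_rpow, intervalIntegral.integral_const, sub_zero,
      smul_eq_mul]
    have hs := Real.mul_self_sqrt hT.le
    rw [show Real.sqrt T * (2 * Real.sqrt T + 2 * Real.sqrt T) = 4 * T by linarith]
    field_simp
  have hIcc : IntegrableOn g (Set.Ioo 0 T) volume :=
    (intervalIntegrable_iff_integrableOn_Ioo_of_le hT.le).1 hgi
  have hle : ∀ t ∈ Set.Ioo 0 T, approxLeverage F T ε t ≤ ENNReal.ofReal (g t) := by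
    intro t ht
    rw [approxLeverage_eq_ofReal hT ht, ← ENNReal.ofReal_mul (by positivity)]
    refine ENNReal.ofReal_le_ofReal ?_
    rw [hg]
    simp only
    rw [div_eq_mul_one_div (bandDegree F T ε : ℝ), ← hq]
    gcongr
    exact inv_sqrt_min_le hT ht
  rw [approxStatDim, ← setLIntegral_congr Ioo_ae_eq_Icc]
  calc ∫⁻ t in Set.Ioo 0 T, approxLeverage F T ε t
      ≤ ∫⁻ t in Set.Ioo 0 T, ENNReal.ofReal (g t) := setLIntegral_mono' measurableSet_Ioo hle
    _ = ENNReal.ofReal (4 + 4 * q) := by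
        rw [← ofReal_integral_eq_lintegral_ofReal hIcc, ← integral_Ioc_eq_integral_Ioo,
          ← intervalIntegral.integral_of_le hT.le, hI]
        filter_upwards [ae_restrict_mem measurableSet_Ioo] with t ht
        have h0 : 0 < T - t := by linarith [ht.2]
        have h1 := ht.1
        simp only [hg, Pi.zero_apply]
        positivity

/-- From `π ≤ 4` and `e < 3`, the three coefficients are at most `768`, `8` and `52`. -/
theorem four_add_four_mul_bandDegree_le {F T ε : ℝ} (hF : 0 < F) (hT : 0 < T) (hε : 0 < ε)
    (hε1 : ε ≤ 1) :
    4 + 4 * (bandDegree F T ε : ℝ) ≤ 1000 * (F * T + Real.log (1 / ε) + 1) := by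
  have hl : 0 ≤ Real.log (1 / ε) := Real.log_nonneg (by rw [le_div_iff₀ hε]; linarith)
  have hA : 0 < F * T := by positivity
  have hq : (bandDegree F T ε : ℝ) ≤
      16 * Real.pi * Real.exp 1 * F * T + 2 * Real.log (1 / ε) + 11 + 1 :=
    (Nat.ceil_lt_add_one (by positivity)).le
  have hpe : Real.pi * Real.exp 1 ≤ 4 * 3 :=
    mul_le_mul Real.pi_le_four Real.exp_one_lt_three.le (Real.exp_pos 1).le (by norm_num)
  have := mul_le_mul_of_nonneg_right hpe hA.le
  linarith

end FourierFit

namespace FourierFit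

/-! ### Operators on Hilbert spaces -/

section Hilbert

theorem tsum_ofReal_norm_inner_sq {ι H : Type*} [NormedAddCommGroup H]
    [InnerProductSpace ℂ H]
    (b : HilbertBasis ι ℂ H) (x : H) :
    ∑' i, ENNReal.ofReal (‖⟪b i, x⟫_ℂ‖ ^ 2) = ENNReal.ofReal (‖x‖ ^ 2) := by
  have h := lp.hasSum_norm (p := 2) (by norm_num) (b.repr x)
  simp only [b.repr_apply_apply, ENNReal.toReal_ofNat, Real.rpow_ofNat, b.repr.norm_map] at h
  rw [← h.tsum_eq, ENNReal.ofReal_tsum_of_nonneg (fun _ => by positivity) h.summable]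

variable {H K : Type} [NormedAddCommGroup H] [InnerProductSpace ℂ H] [CompleteSpace H]
  [NormedAddCommGroup K] [InnerProductSpace ℂ K] [CompleteSpace K]

theorem isUnit_add_smul_one {a : H →L[ℂ] H} (ha : 0 ≤ a) {ε : ℝ} (hε : 0 < ε) :
    IsUnit (a + (ε : ℂ) • (1 : H →L[ℂ] H)) := by
  have h : -ε ∉ spectrum ℝ a := fun h => by
    have := spectrum_nonneg_of_nonneg ha h
    linarith
  rw [spectrum.notMem_iff] at h
  have e : a + (ε : ℂ) • (1 : H →L[ℂ] H) = -(algebraMap ℝ (H →L[ℂ] H) (-ε) - a) := by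
    rw [Algebra.algebraMap_eq_smul_one, neg_smul, neg_sub, sub_neg_eq_add]
    congr 1
  rw [e]
  exact h.neg

/-- Parseval in each basis and an exchange of nonnegative sums. As the right side does not involve
`b`, the trace will not depend on the basis. -/
theorem tsum_ofReal_norm_sq_adjoint {ι κ : Type*} (Q : H →L[ℂ] K) (b : HilbertBasis ι ℂ H)
    (e : HilbertBasis κ ℂ K) :
    ∑' i, ENNReal.ofReal (‖Q (b i)‖ ^ 2) =
      ∑' k, ENNReal.ofReal (‖ContinuousLinearMap.adjoint Q (e k)‖ ^ 2) := by
  simp_rw [← tsum_ofReal_norm_inner_sq e (Q _), ← tsum_ofReal_norm_inner_sq b]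
  rw [ENNReal.tsum_comm]
  refine tsum_congr fun k => tsum_congr fun i => ?_
  rw [ContinuousLinearMap.adjoint_inner_right, norm_inner_symm]

/-- The trace of `Q† Q` is the squared Hilbert-Schmidt norm of `Q†`. -/
theorem hasTrace_adjoint_comp_self {κ : Type*} (Q : H →L[ℂ] K) (e : HilbertBasis κ ℂ K)
    (h : ∑' k, ENNReal.ofReal (‖ContinuousLinearMap.adjoint Q (e k)‖ ^ 2) ≠ ∞) :
    HasTrace (ContinuousLinearMap.adjoint Q ∘L Q)
      ((∑' k, ENNReal.ofReal (‖ContinuousLinearMap.adjoint Q (e k)‖ ^ 2)).toReal : ℝ) := by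
  intro ι b
  rw [← tsum_ofReal_norm_sq_adjoint Q b e] at h ⊢
  have h1 := ENNReal.hasSum_toReal h
  simp only [ENNReal.toReal_ofReal (sq_nonneg _)] at h1
  rw [ENNReal.tsum_toReal_eq fun i => ENNReal.ofReal_ne_top]
  simp only [ENNReal.toReal_ofReal (sq_nonneg _)]
  have h2 := Complex.hasSum_ofReal.2 h1
  convert h2 using 2 with i
  rw [ContinuousLinearMap.comp_apply, ContinuousLinearMap.adjoint_inner_right,
    inner_self_eq_norm_sq_to_K]
  simp


theorem HasTrace.unique {A : H →L[ℂ] H} {s t : ℂ} (hs : HasTrace A s)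
    (ht : HasTrace A t) : s = t := by
  obtain ⟨w, b, _⟩ := exists_hilbertBasis ℂ H
  exact (hs w b).unique (ht w b)

theorem HasTrace.opTrace_eq {A : H →L[ℂ] H} {s : ℂ} (hs : HasTrace A s) : opTrace A = s := by
  have h : ∃ s, HasTrace A s := ⟨s, hs⟩
  rw [opTrace, dif_pos h]
  exact h.choose_spec.unique hs

/-- The resolvent `(A† A + ε)⁻¹`. -/
def resolvent (A : H →L[ℂ] K) (ε : ℝ) : H →L[ℂ] H :=
  Ring.inverse (ContinuousLinearMap.adjoint A ∘L A + (ε : ℂ) • (1 : H →L[ℂ] H))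

theorem adjoint_comp_self_nonneg (A : H →L[ℂ] K) : 0 ≤ ContinuousLinearMap.adjoint A ∘L A :=
  (ContinuousLinearMap.nonneg_iff_isPositive _).2
    (ContinuousLinearMap.isPositive_adjoint_comp_self A)

theorem gram_add_mul_resolvent (A : H →L[ℂ] K) {ε : ℝ} (hε : 0 < ε) :
    (ContinuousLinearMap.adjoint A ∘L A + (ε : ℂ) • (1 : H →L[ℂ] H)) * resolvent A ε = 1 :=
  Ring.mul_inverse_cancel _ (isUnit_add_smul_one (adjoint_comp_self_nonneg A) hε)

theorem resolvent_mul_gram_add (A : H →L[ℂ] K) {ε : ℝ} (hε : 0 < ε) :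
    resolvent A ε * (ContinuousLinearMap.adjoint A ∘L A + (ε : ℂ) • (1 : H →L[ℂ] H)) = 1 :=
  Ring.inverse_mul_cancel _ (isUnit_add_smul_one (adjoint_comp_self_nonneg A) hε)

theorem inner_resolvent (A : H →L[ℂ] K) {ε : ℝ} (hε : 0 < ε) (x : H) :
    ⟪resolvent A ε x, x⟫_ℂ =
      ((‖A (resolvent A ε x)‖ ^ 2 + ε * ‖resolvent A ε x‖ ^ 2 : ℝ) : ℂ) := by
  have h := DFunLike.congr_fun (gram_add_mul_resolvent A hε) x
  simp only [mul_apply_eq_comp, add_apply,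
    ContinuousLinearMap.comp_apply, smul_apply,
    one_apply_eq_self] at h
  set y := resolvent A ε x
  rw [← h]
  rw [inner_add_right, ContinuousLinearMap.adjoint_inner_right, inner_smul_right,
    inner_self_eq_norm_sq_to_K, inner_self_eq_norm_sq_to_K]
  push_cast
  rfl

theorem resolvent_nonneg (A : H →L[ℂ] K) {ε : ℝ} (hε : 0 < ε) : 0 ≤ resolvent A ε := by
  rw [ContinuousLinearMap.nonneg_iff_isPositive, ContinuousLinearMap.isPositive_iff_complex]
  intro x
  rw [inner_resolvent A hε]
  refine ⟨by rw [RCLike.re_to_complex, Complex.ofReal_re], ?_⟩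
  simp only [RCLike.re_to_complex, Complex.ofReal_re]
  positivity

/-- The positive square root of the resolvent `(A† A + ε)⁻¹`. -/
def sqrtResolvent (A : H →L[ℂ] K) (ε : ℝ) : H →L[ℂ] H := CFC.sqrt (resolvent A ε)

theorem sqrtResolvent_mul_self (A : H →L[ℂ] K) {ε : ℝ} (hε : 0 < ε) :
    sqrtResolvent A ε * sqrtResolvent A ε = resolvent A ε :=
  CFC.sqrt_mul_sqrt_self _ (resolvent_nonneg A hε)

theorem adjoint_sqrtResolvent (A : H →L[ℂ] K) (ε : ℝ) :
    ContinuousLinearMap.adjoint (sqrtResolvent A ε) = sqrtResolvent A ε :=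
  (IsSelfAdjoint.of_nonneg (CFC.sqrt_nonneg (resolvent A ε))).star_eq

theorem norm_sqrtResolvent_sq (A : H →L[ℂ] K) {ε : ℝ} (hε : 0 < ε) (x : H) :
    ((‖sqrtResolvent A ε x‖ ^ 2 : ℝ) : ℂ) = ⟪x, resolvent A ε x⟫_ℂ := by
  rw [← sqrtResolvent_mul_self A hε, mul_apply_eq_comp,
    ← ContinuousLinearMap.adjoint_inner_left, adjoint_sqrtResolvent, inner_self_eq_norm_sq_to_K]
  push_cast
  rfl

/-- A bound for the functional `⟪φ, ·⟫` by the ridge form of `A` bounds the ridge energy of `φ`. -/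
theorem norm_sqrtResolvent_sq_le (A : H →L[ℂ] K) {ε : ℝ} (hε : 0 < ε) (φ : H) {B : ℝ} (hB : 0 ≤ B)
    (h : ∀ α : H, ‖⟪φ, α⟫_ℂ‖ ^ 2 ≤ B * (‖A α‖ ^ 2 + ε * ‖α‖ ^ 2)) :
    ‖sqrtResolvent A ε φ‖ ^ 2 ≤ B := by
  have h1 := norm_sqrtResolvent_sq A hε φ
  have h2 : ‖sqrtResolvent A ε φ‖ ^ 2 =
      ‖A (resolvent A ε φ)‖ ^ 2 + ε * ‖resolvent A ε φ‖ ^ 2 := by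
    have h3 := inner_resolvent A hε φ
    rw [← inner_conj_symm, ← h1, Complex.conj_ofReal] at h3
    exact_mod_cast h3
  -- This choice of `α` is extremal: both the pairing with `φ` and the ridge form equal `w`, so `w²
  -- ≤ B w`.
  have h4 := h (resolvent A ε φ)
  rw [← h1, ← h2, Complex.norm_real, Real.norm_of_nonneg (sq_nonneg _)] at h4
  set w := ‖sqrtResolvent A ε φ‖ ^ 2
  by_contra hlt
  push Not at hlt
  nlinarith [sq_nonneg ‖sqrtResolvent A ε φ‖]

/-- The push-through identity `A A† (A A† + ε)⁻¹ = A (A† A + ε)⁻¹ A†`, with the resolvent split into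
two square roots to expose the form `Q† Q`. -/
theorem self_comp_adjoint_mul_inverse (A : H →L[ℂ] K) {ε : ℝ} (hε : 0 < ε) :
    (A ∘L ContinuousLinearMap.adjoint A) *
        Ring.inverse (A ∘L ContinuousLinearMap.adjoint A + (ε : ℂ) • (1 : K →L[ℂ] K)) =
      ContinuousLinearMap.adjoint (sqrtResolvent A ε ∘L ContinuousLinearMap.adjoint A) ∘L
        (sqrtResolvent A ε ∘L ContinuousLinearMap.adjoint A) := by
  have hu : IsUnit (A ∘L ContinuousLinearMap.adjoint A + (ε : ℂ) • (1 : K →L[ℂ] K)) := by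
    have h0 := adjoint_comp_self_nonneg (ContinuousLinearMap.adjoint A)
    rw [ContinuousLinearMap.adjoint_adjoint] at h0
    exact isUnit_add_smul_one h0 hε
  have h1 : ContinuousLinearMap.adjoint (sqrtResolvent A ε ∘L ContinuousLinearMap.adjoint A) ∘L
      (sqrtResolvent A ε ∘L ContinuousLinearMap.adjoint A) =
      A ∘L resolvent A ε ∘L ContinuousLinearMap.adjoint A := by
    rw [ContinuousLinearMap.adjoint_comp, ContinuousLinearMap.adjoint_adjoint,
      adjoint_sqrtResolvent, ← sqrtResolvent_mul_self A hε]
    rfl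
  rw [h1]
  have h2 : (A ∘L resolvent A ε ∘L ContinuousLinearMap.adjoint A) *
      (A ∘L ContinuousLinearMap.adjoint A + (ε : ℂ) • (1 : K →L[ℂ] K)) =
      A ∘L ContinuousLinearMap.adjoint A := by
    ext1 x
    have h3 := DFunLike.congr_fun (resolvent_mul_gram_add A hε) (ContinuousLinearMap.adjoint A x)
    simp only [mul_apply_eq_comp, add_apply,
      ContinuousLinearMap.comp_apply, smul_apply,
      one_apply_eq_self, map_add, map_smul] at h3 ⊢
    rw [← map_smul A, ← map_add, h3]
  nth_rewrite 1 [← h2]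
  rw [mul_assoc, Ring.mul_inverse_cancel _ hu, mul_one]

end Hilbert

/-! ### The kernel operator -/

/-- Fubini, valid since the exponential has modulus one and L² functions of a finite measure are
integrable. -/
theorem adjoint_expOp (σ : ℝ) (ν ρ : Measure ℝ) [IsFiniteMeasure ν] [IsFiniteMeasure ρ] :
    ContinuousLinearMap.adjoint (expOp σ ν ρ) = expOp (-σ) ρ ν := by
  symm
  rw [ContinuousLinearMap.eq_adjoint_iff]
  intro g f
  rw [L2.inner_def, L2.inner_def]
  have h1 : ∫ x, ⟪expOp (-σ) ρ ν g x, f x⟫_ℂ ∂ν =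
      ∫ x, ∫ s, f x * Complex.exp (2 * Real.pi * Complex.I * σ * x * s) *
        (starRingEnd ℂ) (g s) ∂ρ ∂ν := by
    refine integral_congr_ae ?_
    filter_upwards [coeFn_expOp (-σ) ρ ν g] with x hx
    rw [hx, RCLike.inner_apply, expIntegral, ← integral_conj, ← integral_const_mul]
    refine integral_congr_ae (Filter.Eventually.of_forall fun s => ?_)
    simp only [map_mul, ← Complex.exp_conj, Complex.conj_I, Complex.conj_ofReal, map_ofNat]
    rw [show 2 * (Real.pi : ℂ) * -Complex.I * ((-σ : ℝ) : ℂ) * s * x =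
      2 * Real.pi * Complex.I * σ * x * s by push_cast; ring]
    ring
  have h2 : ∫ s, ⟪g s, expOp σ ν ρ f s⟫_ℂ ∂ρ =
      ∫ s, ∫ x, f x * Complex.exp (2 * Real.pi * Complex.I * σ * x * s) *
        (starRingEnd ℂ) (g s) ∂ν ∂ρ := by
    refine integral_congr_ae ?_
    filter_upwards [coeFn_expOp σ ν ρ f] with s hs
    rw [hs, RCLike.inner_apply, expIntegral, ← integral_mul_const]
  rw [h1, h2]
  refine integral_integral_swap ?_
  have hf : Integrable f ν := (Lp.memLp f).integrable (by norm_num)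
  have hg : Integrable (fun s => (starRingEnd ℂ) (g s)) ρ := by
    have : Integrable g ρ := (Lp.memLp g).integrable (by norm_num)
    exact Complex.conjCLE.integrable_comp_iff.2 this
  have h3 := (hf.mul_prod hg).mul_bdd (c := 1)
    (g := fun p : ℝ × ℝ => Complex.exp (2 * Real.pi * Complex.I * σ * p.1 * p.2))
    (Continuous.aestronglyMeasurable (by fun_prop))
    (Filter.Eventually.of_forall fun p => (norm_exp_char σ p.1 p.2).le)
  refine h3.congr (Filter.Eventually.of_forall fun p => ?_)
  simp only [Function.uncurry]
  ring

theorem adjoint_invFourier (μ : Measure ℝ) [IsFiniteMeasure μ] (T : ℝ) :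
    ContinuousLinearMap.adjoint (invFourier μ T) = fourier μ T :=
  adjoint_expOp 1 μ (unif 0 T)

theorem kernelOp_eq (μ : Measure ℝ) [IsFiniteMeasure μ] (T : ℝ) :
    kernelOp μ T = invFourier μ T ∘L ContinuousLinearMap.adjoint (invFourier μ T) := by
  rw [adjoint_invFourier, kernelOp]

theorem exists_inner_eq_expIntegral (σ : ℝ) (ν : Measure ℝ) [IsFiniteMeasure ν] (s : ℝ) :
    ∃ φ : Lp ℂ 2 ν, ∀ f : Lp ℂ 2 ν, expIntegral σ ν f s = ⟪φ, f⟫_ℂ := by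
  refine ⟨(memLp_exp_char σ ν s).toLp _, fun f => ?_⟩
  rw [L2.inner_def]
  refine integral_congr_ae ?_
  filter_upwards [(memLp_exp_char σ ν s).coeFn_toLp] with x hx
  rw [hx, RCLike.inner_apply, ← Complex.exp_conj]
  congr 2
  simp [Complex.conj_ofNat]

theorem ofReal_norm_invFourier_sq (μ : Measure ℝ) [IsFiniteMeasure μ] (T : ℝ) (α : Lp ℂ 2 μ) :
    ENNReal.ofReal (‖invFourier μ T α‖ ^ 2) =
      ∫⁻ t, ENNReal.ofReal (‖expIntegral 1 μ α t‖ ^ 2) ∂(unif 0 T) := by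
  rw [norm_invFourier_sq_eq_integral, ofReal_integral_eq_lintegral_ofReal
    ((memLp_expIntegral 1 μ (unif 0 T) α).integrable_norm_pow two_ne_zero)
    (Filter.Eventually.of_forall fun t => sq_nonneg _)]

/-- At each `t`, self-adjointness of `S` moves it onto `φ`, and Bessel bounds the sum over the basis
by `‖S φ‖²`. Finite partial sums commute with the integral without countability of the basis. -/
theorem tsum_norm_sq_le_approxStatDim {F T ε : ℝ} (hF : 0 < F) (hT : 0 < T) (hε : 0 < ε)
    (hε1 : ε ≤ 1) {κ : Type*} (e : HilbertBasis κ ℂ (Lp ℂ 2 (unif (-F) F))) :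
    ∑' k, ENNReal.ofReal
      (‖invFourier (unif (-F) F) T (sqrtResolvent (invFourier (unif (-F) F) T) ε (e k))‖ ^ 2) ≤
      approxStatDim F T ε := by
  rw [ENNReal.tsum_eq_iSup_sum]
  refine iSup_le fun s => ?_
  set A := invFourier (unif (-F) F) T with hA
  set S := sqrtResolvent A ε with hS
  have hbound : ∀ t ∈ Set.Ioo 0 T,
      ∑ k ∈ s, ENNReal.ofReal (‖expIntegral 1 (unif (-F) F) (S (e k)) t‖ ^ 2) ≤
      ENNReal.ofReal (4 + bandDegree F T ε / Real.sqrt (min t (T - t) / T)) := by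
    intro t ht
    rw [← ENNReal.ofReal_sum_of_nonneg fun _ _ => sq_nonneg _]
    refine ENNReal.ofReal_le_ofReal ?_
    obtain ⟨φ, hφ⟩ := exists_inner_eq_expIntegral 1 (unif (-F) F) t
    have h1 : ∀ k, ‖expIntegral 1 (unif (-F) F) (S (e k)) t‖ ^ 2 = ‖⟪e k, S φ⟫_ℂ‖ ^ 2 := by
      intro k
      rw [hφ, ← ContinuousLinearMap.adjoint_inner_left, hS, adjoint_sqrtResolvent,
        norm_inner_symm]
    simp_rw [h1]
    refine (Orthonormal.sum_inner_products_le (S φ) e.orthonormal).trans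
      (norm_sqrtResolvent_sq_le A hε φ (by positivity) fun α => ?_)
    rw [← hφ]
    exact norm_sq_expIntegral_le hF hT hε hε1 ht α
  calc ∑ k ∈ s, ENNReal.ofReal (‖A (S (e k))‖ ^ 2)
      = ∫⁻ t, ∑ k ∈ s, ENNReal.ofReal (‖expIntegral 1 (unif (-F) F) (S (e k)) t‖ ^ 2)
          ∂(unif 0 T) := by
        rw [lintegral_finsetSum]
        · exact Finset.sum_congr rfl fun k _ => ofReal_norm_invFourier_sq _ _ _
        · intro k _
          have := continuous_expIntegral 1 (unif (-F) F) (S (e k))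
          fun_prop
    _ = ENNReal.ofReal (1 / T) * ∫⁻ t in Set.Ioo 0 T,
          ∑ k ∈ s, ENNReal.ofReal (‖expIntegral 1 (unif (-F) F) (S (e k)) t‖ ^ 2) := by
        rw [unif_eq_smul hT, lintegral_smul_measure, sub_zero, smul_eq_mul,
          setLIntegral_congr Ioo_ae_eq_Icc.symm]
    _ = ∫⁻ t in Set.Ioo 0 T, ENNReal.ofReal (1 / T) *
          ∑ k ∈ s, ENNReal.ofReal (‖expIntegral 1 (unif (-F) F) (S (e k)) t‖ ^ 2) :=
        (lintegral_const_mul' _ _ ENNReal.ofReal_ne_top).symm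
    _ ≤ ∫⁻ t in Set.Ioo 0 T, approxLeverage F T ε t := by
        refine setLIntegral_mono' measurableSet_Ioo fun t ht => ?_
        rw [approxLeverage_eq_ofReal hT ht]
        gcongr
        exact hbound t ht
    _ = approxStatDim F T ε := setLIntegral_congr Ioo_ae_eq_Icc

theorem hasTrace_ridgeOp {F T ε : ℝ} (hF : 0 < F) (hT : 0 < T) (hε : 0 < ε) (hε1 : ε ≤ 1) :
    ∃ s : ℝ, HasTrace (ridgeOp (unif (-F) F) T ε) s ∧ s ≤ (approxStatDim F T ε).toReal := by
  obtain ⟨κ, e, _⟩ := exists_hilbertBasis ℂ (Lp ℂ 2 (unif (-F) F))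
  have hle := tsum_norm_sq_le_approxStatDim hF hT hε hε1 e
  have hfin : approxStatDim F T ε ≠ ∞ :=
    ((approxStatDim_le hT).trans_lt ENNReal.ofReal_lt_top).ne
  set A := invFourier (unif (-F) F) T with hA
  have hadj : ∀ x, ContinuousLinearMap.adjoint
      (sqrtResolvent A ε ∘L ContinuousLinearMap.adjoint A) x = A (sqrtResolvent A ε x) := by
    intro x
    rw [ContinuousLinearMap.adjoint_comp, ContinuousLinearMap.adjoint_adjoint,
      adjoint_sqrtResolvent]
    rfl
  have htr := hasTrace_adjoint_comp_self
    (sqrtResolvent A ε ∘L ContinuousLinearMap.adjoint A) e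
    (by simp_rw [hadj]; exact (hle.trans_lt hfin.lt_top).ne)
  rw [← self_comp_adjoint_mul_inverse A hε] at htr
  simp_rw [hadj] at htr
  refine ⟨_, ?_, ENNReal.toReal_mono hfin hle⟩
  rw [ridgeOp, kernelOp_eq]
  exact htr

theorem isUnit_kernelOp_add (μ : Measure ℝ) [IsFiniteMeasure μ] (T : ℝ) {ε : ℝ} (hε : 0 < ε) :
    IsUnit (kernelOp μ T + (ε : ℂ) • (1 : L2T T →L[ℂ] L2T T)) := by
  rw [kernelOp_eq]
  have h0 := adjoint_comp_self_nonneg (ContinuousLinearMap.adjoint (invFourier μ T))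
  rw [ContinuousLinearMap.adjoint_adjoint] at h0
  exact isUnit_add_smul_one h0 hε

end FourierFit

end

theorem mainTheorem11 :
    ∃ C : ℝ, 0 < C ∧ ∀ F T ε : ℝ, 0 < F → 0 < T → 0 < ε → ε ≤ 1 →
      (∀ t ∈ Set.Icc 0 T,
        FourierFit.leverage (FourierFit.unif (-F) F) T ε t ≤ FourierFit.approxLeverage F T ε t) ∧
      FourierFit.approxStatDim F T ε ≤ ENNReal.ofReal (C * (F * T + Real.log (1 / ε) + 1)) ∧
      IsUnit (FourierFit.kernelOp (FourierFit.unif (-F) F) T +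
        (ε : ℂ) • (1 : FourierFit.L2T T →L[ℂ] FourierFit.L2T T)) ∧
      FourierFit.HasTrace (FourierFit.ridgeOp (FourierFit.unif (-F) F) T ε)
        (FourierFit.statDim (FourierFit.unif (-F) F) T ε : ℂ) ∧
      FourierFit.statDim (FourierFit.unif (-F) F) T ε ≤
        (FourierFit.approxStatDim F T ε).toReal := by
  refine ⟨1000, by norm_num, fun F T ε hF hT hε hε1 => ?_⟩
  obtain ⟨s, hs, hle⟩ := FourierFit.hasTrace_ridgeOp hF hT hε hε1
  have hst : FourierFit.statDim (FourierFit.unif (-F) F) T ε = s := by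
    rw [FourierFit.statDim, hs.opTrace_eq, Complex.ofReal_re]
  refine ⟨fun t ht => FourierFit.leverage_le_approxLeverage hF hT hε hε1 ht, ?_,
    FourierFit.isUnit_kernelOp_add _ T hε, ?_, ?_⟩
  · exact (FourierFit.approxStatDim_le hT).trans
      (ENNReal.ofReal_le_ofReal (FourierFit.four_add_four_mul_bandDegree_le hF hT hε hε1))
  · rw [hst]; exact hs
  · rw [hst]; exact hle
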